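/- A function $h$ is called completely monotonic on $(0,\infty)$ if it has derivatives of all orders there and $(-1)^m h^{(m)}(t)\ge 0$ for all integers $m\ge 0$ and all $t>0$. Let $h$ be completely monotonic on $(0,\infty)$ and let $h(\infty)=\lim_{t\to\infty}h(t)$. We say that $h$ has completely monotonic degree $r$, and write $\deg h=r$, where $r$ is a real number or $\infty$, if for every $\alpha\in\mathbb{R}$ the function $t^{\alpha}[h(t)-h(\infty)]$ is completely monotonic on $(0,\infty)$ if and only if $\alpha\le r$. For integers $n\ge 0$ and $t>0$ let $$R_n(t)=(-1)^n\Biggl[\ln\Gamma(t)-\Bigl(t-\frac12\Bigr)\ln t+t-\frac12\ln(2\pi)-\sum_{k=1}^n\frac{B_{2k}}{2k(2k-1)}\,\frac1{t^{2k-1}}\Biggr],$$ where $B_j$ are the Bernoulli numbers, given by $\frac{z}{e^z-1}=\sum_{j\ge0}B_j\frac{z^j}{j!}$ for $|z|<2\pi$, and an empty sum is $0$. Let $\psi=\Gamma'/\Gamma$ be the digamma function. **Theorem 2.1.** The functions $R_0$ and $R_1$ are completely monotonic on $(0,\infty)$, with $$\deg R_0=0,\qquad \deg R_1=1.$$ For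 every $n\ge0$ the function $R_n$ is differentiable on $(0,\infty)$, with $$-R_n'(t)=(-1)^{n+1}\Biggl[\psi(t)-\ln t+\frac1{2t}+\sum_{k=1}^n\frac{B_{2k}}{2k}\,\frac1{t^{2k}}\Biggr],\qquad t>0.$$ Each $-R_n'$ is completely monotonic on $(0,\infty)$ and has a finite completely monotonic degree, with $$\deg(-R_0')=1,\qquad \deg(-R_1')=2,\qquad 2n-1\le\deg(-R_n')\le 2n\quad\text{for all } n\ge2.$$ -/

import Mathlib

open scoped ContDiff Topology

noncomputable section

/-- `h` is completely monotonic on `(0, ∞)`: it has derivatives of all orders there and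
`(-1) ^ n * h⁽ⁿ⁾(t) ≥ 0` for all `n ≥ 0` and `t > 0`. Since `(0, ∞)` is open, only the values of
`h` on `(0, ∞)` matter. -/
def IsCompletelyMonotonic (h : ℝ → ℝ) : Prop :=
  ContDiffOn ℝ ∞ h (Set.Ioi 0) ∧
    ∀ (n : ℕ) (t : ℝ), 0 < t → 0 ≤ (-1 : ℝ) ^ n * iteratedDeriv n h t

/-- `h` is a completely monotonic function on `(0, ∞)` of completely monotonic degree `r`,
where `r` is a real number or `∞`: with `L = h(∞)` the limit of `h` at infinity, the real numbers
`α` for which `t ^ α * (h t - L)` is completely monotonic on `(0, ∞)` are exactly those with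
`α ≤ r` (so all real numbers when `r = ∞`). The value `r = -∞` is never taken, as `α = 0` is
always admissible. -/
def HasCMDegree (h : ℝ → ℝ) (r : EReal) : Prop :=
  IsCompletelyMonotonic h ∧
    ∃ L : ℝ, Filter.Tendsto h Filter.atTop (𝓝 L) ∧
      ∀ α : ℝ, IsCompletelyMonotonic (fun t : ℝ => t ^ α * (h t - L)) ↔ (α : EReal) ≤ r

/-- The completely monotonic degree is unique. -/
theorem HasCMDegree.unique {h : ℝ → ℝ} {r s : EReal}
    (hr : HasCMDegree h r) (hs : HasCMDegree h s) : r = s := by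
  obtain ⟨-, L, hL, hr⟩ := hr
  obtain ⟨-, M, hM, hs⟩ := hs
  obtain rfl := tendsto_nhds_unique hL hM
  have key : ∀ α : ℝ, (α : EReal) ≤ r ↔ (α : EReal) ≤ s := fun α => (hr α).symm.trans (hs α)
  exact le_antisymm (EReal.le_of_forall_lt_iff_le.1 fun z hz => by
      by_contra hc
      exact absurd ((key z).1 (not_le.1 hc).le) (not_le.2 hz))
    (EReal.le_of_forall_lt_iff_le.1 fun z hz => by
      by_contra hc
      exact absurd ((key z).2 (not_le.1 hc).le) (not_le.2 hz))

/-- The digamma function `ψ = Γ' / Γ` on the real line. -/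
def digammaReal (t : ℝ) : ℝ := deriv Real.Gamma t / Real.Gamma t

/-- The signed remainder `R_n` of Stirling's asymptotic expansion of `ln Γ(t)`. -/
def stirlingRemainder (n : ℕ) (t : ℝ) : ℝ :=
  (-1 : ℝ) ^ n *
    (Real.log (Real.Gamma t) - (t - 1 / 2) * Real.log t + t - 1 / 2 * Real.log (2 * Real.pi)
      - ∑ k ∈ Finset.Icc 1 n,
          ((bernoulli (2 * k) : ℚ) : ℝ) / ((2 * (k : ℝ)) * (2 * (k : ℝ) - 1))
            * (1 / t ^ (2 * k - 1)))

end

/-!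
The remainders are Laplace transforms of explicit densities, and complete monotonicity, also after
multiplication by a power of `t`, is read off from the sign of a density.

*Representation.* With `a` running through the pole heights `2π, 4π, …`, Binet's function
`binet t = ∫₀^∞ ∑ 2 / (x² + a²) e^{-tx} dx` satisfies the same difference equation as the error term
in Stirling's formula (`binet_sub`), because its density multiplied by `x² (1 - e^{-x})` is
elementary. The Bohr-Mollerup theorem and the limit in Stirling's formula then give
`R_0 = binet` (`log_Gamma_eq_binet`). Hence `-R_0'` is the transform of
`∑ 2x / (x² + a²) = ∑ 2 Re (x + ia)⁻¹`.

*Powers of `t`.* Integrating by parts, `t` times the transform of `Re (x + ia)^{-(k+1)}` is its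
value at the origin minus `k + 1` times the transform of `Re (x + ia)^{-(k+2)}`. Summed over `a`,
the boundary terms are zeta values at even integers, that is, the Bernoulli terms subtracted in
`R_n`. So `t^{2n} (-R_n')` is `(-1)^n (2n)!` times the transform of `∑ 2 Re (x + ia)^{-(2n+1)}`
(`pow_mul_neg_deriv_stirlingRemainder`), and `t^{2n-1} (-R_n')` is the transform of a sum of
differences between `a^{-2n}` and `± Re (x + ia)^{-2n}`, which are nonnegative because
`|x + ia| ≥ a` (`isCompletelyMonotonic_laplace_poleDensity_div`). The sharp exponents for `n = 0, 1`
need `∑ Re (x + ia)⁻² ≤ 0` and `∑ Re (x + ia)⁻³ ≤ 0`; the Lipschitz formula turns these into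
`y ≤ sinh y` and `y³ cosh y ≤ sinh³ y` with `y = x / 2`.

*Upper bounds.* A completely monotonic function that tends to zero at the origin is zero. As
`t^{2n} (-R_n')` (for `n ≥ 1`), `t (-R_0')` and `t R_1` have nonzero limits at the origin, and `R_0`
has only a logarithmic singularity there, larger exponents are excluded. The degree of `-R_n'`
exists because the admissible exponents form a closed set
(`isClosed_setOf_isCompletelyMonotonic_rpow_mul`).
-/

section

open Real Set Filter MeasureTheory

/-! ### Completely monotonic functions -/

theorem IsCompletelyMonotonic.congr {f g : ℝ → ℝ} (hf : IsCompletelyMonotonic f)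
    (h : ∀ t, 0 < t → g t = f t) : IsCompletelyMonotonic g := by
  refine ⟨hf.1.congr fun t ht => h t ht, fun n t ht => ?_⟩
  have he : g =ᶠ[𝓝 t] f := by
    filter_upwards [Ioi_mem_nhds ht] with s hs using h s hs
  rw [he.iteratedDeriv_eq n]
  exact hf.2 n t ht

theorem IsCompletelyMonotonic.contDiffAt {f : ℝ → ℝ} (hf : IsCompletelyMonotonic f) {t : ℝ}
    (ht : 0 < t) (n : ℕ) : ContDiffAt ℝ n f t :=
  (hf.1.contDiffAt (Ioi_mem_nhds ht)).of_le (by exact_mod_cast le_top)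

theorem IsCompletelyMonotonic.nonneg {f : ℝ → ℝ} (hf : IsCompletelyMonotonic f) {t : ℝ}
    (ht : 0 < t) : 0 ≤ f t := by
  simpa using hf.2 0 t ht

theorem IsCompletelyMonotonic.mul {f g : ℝ → ℝ} (hf : IsCompletelyMonotonic f)
    (hg : IsCompletelyMonotonic g) : IsCompletelyMonotonic (fun t => f t * g t) := by
  refine ⟨hf.1.mul hg.1, fun n t ht => ?_⟩
  rw [iteratedDeriv_fun_mul (hf.contDiffAt ht n) (hg.contDiffAt ht n), Finset.mul_sum]
  refine Finset.sum_nonneg fun i hi => ?_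
  have hin : i ≤ n := Nat.lt_succ_iff.1 (Finset.mem_range.1 hi)
  have h1 := mul_nonneg (hf.2 i t ht) (hg.2 (n - i) t ht)
  have h2 : (-1 : ℝ) ^ n = (-1) ^ i * (-1) ^ (n - i) := by
    rw [← pow_add, Nat.add_sub_cancel' hin]
  have h3 : (-1 : ℝ) ^ n * (n.choose i * iteratedDeriv i f t * iteratedDeriv (n - i) g t)
      = n.choose i * ((-1) ^ i * iteratedDeriv i f t
        * ((-1) ^ (n - i) * iteratedDeriv (n - i) g t)) := by
    rw [h2]; ring
  rw [h3]
  exact mul_nonneg (Nat.cast_nonneg _) h1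

theorem IsCompletelyMonotonic.antitoneOn {f : ℝ → ℝ} (hf : IsCompletelyMonotonic f) :
    AntitoneOn f (Ioi 0) := by
  refine antitoneOn_of_deriv_nonpos (convex_Ioi 0) hf.1.continuousOn ?_ fun t ht => ?_
  · rw [interior_Ioi]
    exact hf.1.differentiableOn (by simp)
  · rw [interior_Ioi] at ht
    simpa using hf.2 1 t ht

/-- A family of nonnegative functions, each of which is minus the derivative of the one before,
starts with a completely monotonic function. -/
theorem isCompletelyMonotonic_of_hasDerivAt {F : ℕ → ℝ → ℝ}
    (hF : ∀ n t, 0 < t → HasDerivAt (F n) (-F (n + 1) t) t) (h0 : ∀ n t, 0 < t → 0 ≤ F n t) :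
    IsCompletelyMonotonic (F 0) := by
  have hd : ∀ k n : ℕ, ContDiffOn ℝ k (F n) (Ioi 0) := by
    intro k
    induction k with
    | zero =>
      intro n
      rw [Nat.cast_zero, contDiffOn_zero]
      exact fun t ht => (hF n t ht).continuousAt.continuousWithinAt
    | succ k ih =>
      intro n
      rw [Nat.cast_succ, contDiffOn_succ_iff_deriv_of_isOpen isOpen_Ioi]
      refine ⟨fun t ht => (hF n t ht).differentiableAt.differentiableWithinAt, by simp, ?_⟩
      exact (ih (n + 1)).neg.congr fun t ht => (hF n t ht).deriv
  have hi : ∀ n t, 0 < t → iteratedDeriv n (F 0) t = (-1) ^ n * F n t := by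
    intro n
    induction n with
    | zero => simp
    | succ n ih =>
      intro t ht
      have he : iteratedDeriv n (F 0) =ᶠ[𝓝 t] fun s => (-1) ^ n * F n s := by
        filter_upwards [Ioi_mem_nhds ht] with s hs using ih s hs
      rw [iteratedDeriv_succ, he.deriv_eq, ((hF n t ht).const_mul _).deriv]
      ring
  refine ⟨contDiffOn_infty.2 fun k => hd k 0, fun n t ht => ?_⟩
  rw [hi n t ht, ← mul_assoc, ← mul_pow]
  simpa using h0 n t ht

theorem isCompletelyMonotonic_rpow_neg {β : ℝ} (hβ : 0 ≤ β) :
    IsCompletelyMonotonic (fun t => t ^ (-β)) := by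
  have h := isCompletelyMonotonic_of_hasDerivAt
    (F := fun n t => (∏ i ∈ Finset.range n, (β + i)) * t ^ (-β - n)) (fun n t ht => ?_)
    (fun n t ht => by positivity)
  · exact h.congr fun t _ => by simp
  · have h1 := (Real.hasDerivAt_rpow_const (p := -β - n) (Or.inl ht.ne')).const_mul
      (∏ i ∈ Finset.range n, (β + i))
    refine h1.congr_deriv ?_
    rw [Finset.prod_range_succ, show -β - ((n + 1 : ℕ) : ℝ) = -β - n - 1 by push_cast; ring]
    ring

theorem IsCompletelyMonotonic.const_mul {f : ℝ → ℝ} (hf : IsCompletelyMonotonic f) {c : ℝ}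
    (hc : 0 ≤ c) : IsCompletelyMonotonic (fun t => c * f t) := by
  refine ⟨contDiffOn_const.mul hf.1, fun n t ht => ?_⟩
  rw [iteratedDeriv_const_mul_field, mul_left_comm]
  exact mul_nonneg hc (hf.2 n t ht)

/-- Lowering the exponent of the power factor preserves complete monotonicity. -/
theorem IsCompletelyMonotonic.rpow_mul_of_le {f : ℝ → ℝ} {α β : ℝ}
    (hf : IsCompletelyMonotonic (fun t => t ^ β * f t)) (h : α ≤ β) :
    IsCompletelyMonotonic (fun t => t ^ α * f t) := by
  refine ((isCompletelyMonotonic_rpow_neg (sub_nonneg.2 h)).mul hf).congr fun t ht => ?_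
  rw [← mul_assoc, ← Real.rpow_add ht]
  congr 2
  ring

/-- The derivatives of `t ^ α * f t` depend continuously on the exponent, so the admissible
exponents form a closed set. -/
theorem isClosed_setOf_isCompletelyMonotonic_rpow_mul {f : ℝ → ℝ}
    (hf : ContDiffOn ℝ ∞ f (Ioi 0)) :
    IsClosed {α : ℝ | IsCompletelyMonotonic (fun t => t ^ α * f t)} := by
  have hrc : ∀ (α t : ℝ), 0 < t → ∀ n : ℕ, ContDiffAt ℝ n (fun s : ℝ => s ^ α) t :=
    fun α t ht n => Real.contDiffAt_rpow_const_of_ne ht.ne'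
  have hsm : ∀ α : ℝ, ContDiffOn ℝ ∞ (fun t => t ^ α * f t) (Ioi 0) := fun α =>
    ContDiffOn.mul (fun t ht => (Real.contDiffAt_rpow_const_of_ne
      (ne_of_gt ht)).contDiffWithinAt) hf
  have hset : {α : ℝ | IsCompletelyMonotonic (fun t => t ^ α * f t)} =
      ⋂ (n : ℕ) (t : ℝ) (_ : 0 < t),
        {α : ℝ | 0 ≤ (-1 : ℝ) ^ n * iteratedDeriv n (fun t => t ^ α * f t) t} := by
    ext α
    simp only [mem_ofPred_eq, mem_iInter]
    exact ⟨fun h => h.2, fun h => ⟨hsm α, h⟩⟩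
  rw [hset]
  refine isClosed_iInter fun n => isClosed_iInter fun t => isClosed_iInter fun ht => ?_
  refine isClosed_le continuous_const (continuous_const.mul ?_)
  have hfc : ContDiffAt ℝ n f t :=
    (hf.contDiffAt (Ioi_mem_nhds ht)).of_le (by exact_mod_cast le_top)
  simp_rw [fun α : ℝ => iteratedDeriv_fun_mul (hrc α t ht n) hfc, iteratedDeriv_eq_iterate,
    Real.iter_deriv_rpow_const]
  refine continuous_finsetSum _ fun i _ => ((continuous_const.mul ?_).mul continuous_const)
  refine (Polynomial.continuous _).mul ?_
  exact Real.continuous_const_rpow ht.ne' |>.comp (continuous_id.sub continuous_const)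

/-! ### The completely monotonic degree -/

theorem tendsto_zero_of_isCompletelyMonotonic_rpow_mul {f : ℝ → ℝ} {β : ℝ} (hβ : 0 < β)
    (hf : IsCompletelyMonotonic (fun t => t ^ β * f t)) : Tendsto f atTop (𝓝 0) := by
  have hz : Tendsto (fun t : ℝ => f 1 * t ^ (-β)) atTop (𝓝 0) := by
    simpa using (tendsto_rpow_neg_atTop hβ).const_mul (f 1)
  refine tendsto_of_tendsto_of_tendsto_of_le_of_le' tendsto_const_nhds hz ?_ ?_
  · filter_upwards [eventually_gt_atTop 0] with t ht
    exact nonneg_of_mul_nonneg_right (hf.nonneg ht) (Real.rpow_pos_of_pos ht β)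
  · filter_upwards [eventually_ge_atTop 1] with t ht
    have ht0 : 0 < t := one_pos.trans_le ht
    have h := hf.antitoneOn (mem_Ioi.2 one_pos) (mem_Ioi.2 ht0) ht
    simp only [Real.one_rpow, one_mul] at h
    rw [Real.rpow_neg ht0.le, ← div_eq_mul_inv, le_div_iff₀ (Real.rpow_pos_of_pos ht0 β), mul_comm]
    exact h

/-- A completely monotonic function that tends to zero at the origin vanishes, since it is
nonnegative and nonincreasing. -/
theorem not_isCompletelyMonotonic_rpow_mul {f : ℝ → ℝ} {α : ℝ}
    (h0 : Tendsto (fun t => t ^ α * f t) (𝓝[>] 0) (𝓝 0)) (hf : ∃ t, 0 < t ∧ f t ≠ 0) :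
    ¬ IsCompletelyMonotonic (fun t => t ^ α * f t) := by
  rintro hc
  obtain ⟨t, ht, hne⟩ := hf
  have hle : t ^ α * f t ≤ 0 := by
    refine ge_of_tendsto h0 ?_
    filter_upwards [Ioo_mem_nhdsGT ht] with s hs
    exact hc.antitoneOn (mem_Ioi.2 hs.1) (mem_Ioi.2 ht) hs.2.le
  have h1 : t ^ α * f t = 0 := le_antisymm hle (hc.nonneg ht)
  rcases mul_eq_zero.1 h1 with h | h
  · exact (Real.rpow_pos_of_pos ht α).ne' h
  · exact hne h

/-- If `t ^ γ * f t` has a limit at the origin, then `t ^ α * f t` tends to zero there for all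
larger exponents `α`. -/
theorem tendsto_rpow_mul_zero_of_lt {f : ℝ → ℝ} {γ α c : ℝ} (hα : γ < α)
    (h : Tendsto (fun t => t ^ γ * f t) (𝓝[>] 0) (𝓝 c)) :
    Tendsto (fun t => t ^ α * f t) (𝓝[>] 0) (𝓝 0) := by
  have h1 : Tendsto (fun t : ℝ => t ^ (α - γ)) (𝓝[>] 0) (𝓝 0) := by
    have := (Real.continuousAt_rpow_const 0 (α - γ) (Or.inr (sub_pos.2 hα).le)).tendsto
    rw [Real.zero_rpow (sub_pos.2 hα).ne'] at this
    exact this.mono_left nhdsWithin_le_nhds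
  have h2 := h1.mul h
  rw [zero_mul] at h2
  refine h2.congr' ?_
  filter_upwards [self_mem_nhdsWithin] with t ht
  rw [← mul_assoc, ← Real.rpow_add ht]
  congr 2
  ring

theorem exists_ne_zero_of_tendsto {f : ℝ → ℝ} {γ c : ℝ} (hc : c ≠ 0)
    (h : Tendsto (fun t => t ^ γ * f t) (𝓝[>] 0) (𝓝 c)) : ∃ t, 0 < t ∧ f t ≠ 0 := by
  by_contra! hcon
  refine hc (tendsto_nhds_unique h (tendsto_const_nhds.congr' ?_))
  filter_upwards [self_mem_nhdsWithin] with t ht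
  rw [hcon t ht, mul_zero]

theorem hasCMDegree_of_tendsto_zero {f : ℝ → ℝ} {r : ℝ} (hr : 0 ≤ r)
    (hinf : Tendsto f atTop (𝓝 0)) (hf : IsCompletelyMonotonic (fun t => t ^ r * f t))
    (hgt : ∀ α, r < α → ¬ IsCompletelyMonotonic (fun t => t ^ α * f t)) :
    HasCMDegree f (r : EReal) := by
  refine ⟨(hf.rpow_mul_of_le hr).congr fun t _ => by simp, 0, hinf, fun α => ?_⟩
  simp only [sub_zero, EReal.coe_le_coe_iff]
  exact ⟨fun h => not_lt.1 fun hlt => hgt α hlt h, fun h => hf.rpow_mul_of_le h⟩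

/-- A function with one admissible positive exponent `β` whose product with `t ^ γ` has a nonzero
limit at the origin has a degree in `[β, γ]`. -/
theorem exists_hasCMDegree_mem_Icc {f : ℝ → ℝ} {β γ c : ℝ} (hβ : 0 < β) (hc : c ≠ 0)
    (hf : IsCompletelyMonotonic (fun t => t ^ β * f t))
    (h0 : Tendsto (fun t => t ^ γ * f t) (𝓝[>] 0) (𝓝 c)) :
    ∃ r : ℝ, HasCMDegree f (r : EReal) ∧ β ≤ r ∧ r ≤ γ := by
  have hcm : IsCompletelyMonotonic f := (hf.rpow_mul_of_le hβ.le).congr fun t _ => by simp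
  set S := {α : ℝ | IsCompletelyMonotonic (fun t => t ^ α * f t)}
  have hub : ∀ α ∈ S, α ≤ γ := fun α hα => not_lt.1 fun hlt =>
    not_isCompletelyMonotonic_rpow_mul (tendsto_rpow_mul_zero_of_lt hlt h0)
      (exists_ne_zero_of_tendsto hc h0) hα
  have hbdd : BddAbove S := ⟨γ, hub⟩
  have hmem : sSup S ∈ S :=
    (isClosed_setOf_isCompletelyMonotonic_rpow_mul hcm.1).csSup_mem ⟨β, hf⟩ hbdd
  have hle : β ≤ sSup S := le_csSup hbdd hf
  refine ⟨sSup S, ?_, hle, hub _ hmem⟩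
  exact hasCMDegree_of_tendsto_zero (hβ.le.trans hle)
    (tendsto_zero_of_isCompletelyMonotonic_rpow_mul hβ hf) hmem
    fun α hα h => hα.not_ge (le_csSup hbdd h)

/-! ### Laplace transforms on the half-line -/

/-- The Laplace transform `∫₀^∞ f(x) e^{-tx} dx`. -/
noncomputable def laplace (f : ℝ → ℝ) (t : ℝ) : ℝ := ∫ x in Ioi (0 : ℝ), f x * exp (-(t * x))

/-- The Laplace integral of `f` converges absolutely at every `t > 0`. -/
def LaplaceConvergent (f : ℝ → ℝ) : Prop :=
  ∀ t : ℝ, 0 < t → IntegrableOn (fun x => f x * exp (-(t * x))) (Ioi 0)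

theorem laplace_congr {f g : ℝ → ℝ} (h : ∀ x, 0 < x → f x = g x) (t : ℝ) :
    laplace f t = laplace g t :=
  setIntegral_congr_fun measurableSet_Ioi fun x hx => by simp only [h x hx]

namespace LaplaceConvergent

variable {f g : ℝ → ℝ}

theorem congr (hf : LaplaceConvergent f) (h : ∀ x, 0 < x → g x = f x) : LaplaceConvergent g :=
  fun t ht => (hf t ht).congr_fun (fun x hx => by simp only [h x hx]) measurableSet_Ioi

theorem aestronglyMeasurable (hf : LaplaceConvergent f) :
    AEStronglyMeasurable f (volume.restrict (Ioi 0)) := by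
  have h1 : AEStronglyMeasurable (fun x : ℝ => exp (1 * x)) (volume.restrict (Ioi 0)) :=
    (by fun_prop : Continuous fun x : ℝ => exp (1 * x)).aestronglyMeasurable
  refine ((hf 1 one_pos).aestronglyMeasurable.mul h1).congr (.of_forall fun x => ?_)
  simp [mul_assoc, ← Real.exp_add]

theorem mono (hg : LaplaceConvergent g)
    (hf : AEStronglyMeasurable f (volume.restrict (Ioi 0))) (h : ∀ x, 0 < x → |f x| ≤ |g x|) :
    LaplaceConvergent f := by
  intro t ht
  refine Integrable.mono (hg t ht) (hf.mul ?_) ?_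
  · exact (by fun_prop : Continuous fun x : ℝ => exp (-(t * x))).aestronglyMeasurable
  · filter_upwards [ae_restrict_mem measurableSet_Ioi] with x hx
    simp only [norm_mul, Real.norm_eq_abs]
    exact mul_le_mul_of_nonneg_right (h x hx) (abs_nonneg _)

theorem const (c : ℝ) : LaplaceConvergent (fun _ => c) := by
  intro t ht
  have h : IntegrableOn (fun x => c * exp (-t * x)) (Ioi 0) :=
    Integrable.const_mul (integrableOn_exp_mul_Ioi (neg_lt_zero.2 ht) 0) c
  exact h.congr_fun (fun x _ => by simp) measurableSet_Ioi

theorem of_bound (hf : AEStronglyMeasurable f (volume.restrict (Ioi 0))) {C : ℝ}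
    (h : ∀ x, 0 < x → |f x| ≤ C) : LaplaceConvergent f :=
  (const C).mono hf fun x hx => (h x hx).trans (le_abs_self C)

theorem add (hf : LaplaceConvergent f) (hg : LaplaceConvergent g) :
    LaplaceConvergent (fun x => f x + g x) := fun t ht => by
  simp only [add_mul]
  exact Integrable.add (hf t ht) (hg t ht)

theorem sub (hf : LaplaceConvergent f) (hg : LaplaceConvergent g) :
    LaplaceConvergent (fun x => f x - g x) := fun t ht => by
  simp only [sub_mul]
  exact Integrable.sub (hf t ht) (hg t ht)

theorem const_mul (hf : LaplaceConvergent f) (c : ℝ) : LaplaceConvergent (fun x => c * f x) :=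
  fun t ht => by
    simp only [mul_assoc]
    exact Integrable.const_mul (hf t ht) c

theorem id_mul (hf : LaplaceConvergent f) : LaplaceConvergent (fun x => x * f x) := by
  intro t ht
  have ht2 : 0 < t / 2 := half_pos ht
  refine Integrable.mono (Integrable.const_mul (hf (t / 2) ht2) (2 / t))
    ((continuous_id.aestronglyMeasurable.mul hf.aestronglyMeasurable).mul
      (by fun_prop : Continuous fun x : ℝ => exp (-(t * x))).aestronglyMeasurable) ?_
  filter_upwards [ae_restrict_mem measurableSet_Ioi] with x hx
  have hx0 : 0 < x := hx
  have h1 : x * exp (-(t / 2 * x)) ≤ 2 / t := by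
    rw [Real.exp_neg, ← div_eq_mul_inv, div_le_div_iff₀ (Real.exp_pos _) ht]
    have := Real.add_one_le_exp (t / 2 * x)
    linarith
  have h2 : exp (-(t * x)) = exp (-(t / 2 * x)) * exp (-(t / 2 * x)) := by
    rw [← Real.exp_add]; ring_nf
  simp only [norm_mul, Real.norm_eq_abs, Real.abs_exp, h2, abs_of_pos hx0,
    abs_of_pos (div_pos two_pos ht)]
  have h3 := mul_le_mul_of_nonneg_right h1 (mul_nonneg (abs_nonneg (f x)) (Real.exp_pos
    (-(t / 2 * x))).le)
  calc _ = x * exp (-(t / 2 * x)) * (|f x| * exp (-(t / 2 * x))) := by ring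
    _ ≤ _ := h3

theorem pow_mul (hf : LaplaceConvergent f) (n : ℕ) : LaplaceConvergent (fun x => x ^ n * f x) := by
  induction n with
  | zero => simpa using hf
  | succ n ih => exact ih.id_mul.congr fun x _ => by ring

theorem mul_exp_neg (hf : LaplaceConvergent f) : LaplaceConvergent (fun x => f x * exp (-x)) := by
  intro t ht
  refine (hf (t + 1) (by linarith)).congr_fun (fun x _ => ?_) measurableSet_Ioi
  simp only [mul_assoc, ← Real.exp_add]
  ring_nf

theorem laplace_add (hf : LaplaceConvergent f) (hg : LaplaceConvergent g) {t : ℝ} (ht : 0 < t) :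
    laplace (fun x => f x + g x) t = laplace f t + laplace g t := by
  simp only [laplace, add_mul]
  exact integral_add (hf t ht) (hg t ht)

theorem laplace_sub (hf : LaplaceConvergent f) (hg : LaplaceConvergent g) {t : ℝ} (ht : 0 < t) :
    laplace (fun x => f x - g x) t = laplace f t - laplace g t := by
  simp only [laplace, sub_mul]
  exact integral_sub (hf t ht) (hg t ht)

/-- Differentiation under the Laplace integral. -/
theorem hasDerivAt (hf : LaplaceConvergent f) {t : ℝ} (ht : 0 < t) :
    HasDerivAt (laplace f) (-laplace (fun x => x * f x) t) t := by
  have hexp : ∀ s : ℝ, Continuous fun x : ℝ => exp (-(s * x)) := fun s => by fun_prop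
  have hm := hf.aestronglyMeasurable
  have h := hasDerivAt_integral_of_dominated_loc_of_deriv_le
    (μ := volume.restrict (Ioi (0 : ℝ))) (x₀ := t) (s := Ioi (t / 2))
    (F := fun s x => f x * exp (-(s * x))) (F' := fun s x => -(x * f x * exp (-(s * x))))
    (bound := fun x => |x * f x * exp (-(t / 2 * x))|)
    (Ioi_mem_nhds (half_lt_self ht))
    (.of_forall fun s => hm.mul (hexp s).aestronglyMeasurable)
    (hf t ht) (hf.id_mul t ht).neg.aestronglyMeasurable ?_
    (hf.id_mul (t / 2) (half_pos ht)).norm ?_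
  · refine h.2.congr_deriv ?_
    rw [laplace, ← integral_neg]
  · filter_upwards [ae_restrict_mem measurableSet_Ioi] with x hx s hs
    simp only [norm_neg, Real.norm_eq_abs, abs_mul, Real.abs_exp]
    refine mul_le_mul_of_nonneg_left (Real.exp_le_exp.2 ?_) (by positivity)
    exact neg_le_neg (mul_le_mul_of_nonneg_right (le_of_lt hs) (le_of_lt hx))
  · filter_upwards with x s _
    have h1 : HasDerivAt (fun s : ℝ => -(s * x)) (-x) s := by
      simpa using (hasDerivAt_mul_const x (x := s)).fun_neg
    exact (h1.exp.const_mul (f x)).congr_deriv (by ring)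

/-- The Laplace transform of a nonnegative function is completely monotonic. -/
theorem isCompletelyMonotonic (hf : LaplaceConvergent f) (h0 : ∀ x, 0 < x → 0 ≤ f x) :
    IsCompletelyMonotonic (laplace f) := by
  have h := isCompletelyMonotonic_of_hasDerivAt (F := fun n => laplace (fun x => x ^ n * f x))
    (fun n t ht => ?_) (fun n t _ => ?_)
  · simpa using h
  · refine ((hf.pow_mul n).hasDerivAt ht).congr_deriv (congrArg Neg.neg ?_)
    exact laplace_congr (fun x _ => by ring) t
  · refine setIntegral_nonneg measurableSet_Ioi fun x (hx : 0 < x) => ?_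
    exact mul_nonneg (mul_nonneg (pow_nonneg hx.le n) (h0 x hx)) (Real.exp_pos _).le

end LaplaceConvergent

theorem laplace_const_mul (c : ℝ) (f : ℝ → ℝ) (t : ℝ) :
    laplace (fun x => c * f x) t = c * laplace f t := by
  simp only [laplace, mul_assoc]
  exact integral_const_mul _ _

theorem laplace_mul_exp_neg (f : ℝ → ℝ) (t : ℝ) :
    laplace (fun x => f x * exp (-x)) t = laplace f (t + 1) := by
  refine setIntegral_congr_fun measurableSet_Ioi fun x _ => ?_
  simp only [mul_assoc, ← Real.exp_add]
  ring_nf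

/-- Integration by parts: `t` times the transform of `f` is `f(0)` plus the transform of `f'`. -/
theorem mul_laplace_eq {f f' : ℝ → ℝ} (hd : ∀ x, HasDerivAt f (f' x) x) {C : ℝ}
    (hC : ∀ x, 0 < x → |f x| ≤ C) (hf' : LaplaceConvergent f') {t : ℝ} (ht : 0 < t) :
    t * laplace f t = f 0 + laplace f' t := by
  have hcont : Continuous f := continuous_iff_continuousAt.2 fun x => (hd x).continuousAt
  have hf : LaplaceConvergent f := .of_bound hcont.aestronglyMeasurable hC
  have hlin : ∀ x : ℝ, HasDerivAt (fun x : ℝ => -(t * x)) (-t) x := fun x => by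
    simpa using ((hasDerivAt_id x).const_mul t).fun_neg
  have htop : Tendsto (fun x => f x * exp (-(t * x))) atTop (𝓝 0) := by
    have h1 : Tendsto (fun x : ℝ => exp (-(t * x))) atTop (𝓝 0) :=
      Real.tendsto_exp_neg_atTop_nhds_zero.comp (tendsto_id.const_mul_atTop ht)
    refine squeeze_zero_norm' ?_ (by simpa using h1.const_mul C)
    filter_upwards [eventually_gt_atTop 0] with x hx
    rw [norm_mul, Real.norm_eq_abs, Real.norm_eq_abs, Real.abs_exp]
    exact mul_le_mul_of_nonneg_right (hC x hx) (Real.exp_pos _).le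
  have h := integral_Ioi_of_hasDerivAt_of_tendsto' (a := 0) (m := 0)
    (f := fun x => f x * exp (-(t * x)))
    (f' := fun x => f' x * exp (-(t * x)) - t * (f x * exp (-(t * x))))
    (fun x _ => ((hd x).mul (hlin x).exp).congr_deriv (by ring))
    ((hf' t ht).sub ((hf t ht).const_mul t)) htop
  rw [integral_sub (hf' t ht) ((hf t ht).const_mul t), integral_const_mul] at h
  simp only [mul_zero, neg_zero, Real.exp_zero, mul_one, zero_sub] at h
  simp only [laplace]
  linarith

theorem laplace_const (c : ℝ) {t : ℝ} (ht : 0 < t) : laplace (fun _ => c) t = c / t := by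
  have h := mul_laplace_eq (f := fun _ => c) (f' := fun _ => 0) (fun x => hasDerivAt_const x c)
    (C := |c|) (fun _ _ => le_rfl) (.const 0) ht
  rw [eq_div_iff ht.ne', mul_comm, h]
  simp [laplace]

theorem laplace_id {t : ℝ} (ht : 0 < t) : laplace (fun x => x) t = 1 / t ^ 2 := by
  have h1 := (LaplaceConvergent.const 1).hasDerivAt ht
  have h2 : HasDerivAt (laplace fun _ => 1) (-(t ^ 2)⁻¹) t := by
    refine (hasDerivAt_inv ht.ne').congr_of_eventuallyEq ?_
    filter_upwards [Ioi_mem_nhds ht] with s hs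
    rw [laplace_const 1 hs, one_div]
  have h3 := h1.unique h2
  simp only [mul_one, neg_inj] at h3
  rw [h3, one_div]

/-- Termwise Laplace transformation of a series dominated by a summable multiple of `w`. -/
theorem hasSum_laplace {f : ℕ → ℝ → ℝ} {c : ℕ → ℝ} {w : ℝ → ℝ}
    (hf : ∀ m, AEStronglyMeasurable (f m) (volume.restrict (Ioi 0))) (hc : Summable c)
    (hw : LaplaceConvergent w) (hb : ∀ m x, 0 < x → |f m x| ≤ c m * w x) {t : ℝ} (ht : 0 < t) :
    HasSum (fun m => laplace (f m) t) (laplace (fun x => ∑' m, f m x) t) := by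
  have hcv : ∀ m, LaplaceConvergent (f m) := fun m =>
    (hw.const_mul (c m)).mono (hf m) fun x hx => (hb m x hx).trans (le_abs_self _)
  have h := hasSum_integral_of_summable_integral_norm (fun m => hcv m t ht) ?_
  · simpa only [laplace, tsum_mul_right] using h
  · refine (hc.mul_right (laplace w t)).of_nonneg_of_le
      (fun m => integral_nonneg fun x => norm_nonneg _) fun m => ?_
    rw [laplace, ← integral_const_mul]
    refine setIntegral_mono_on (hcv m t ht).norm ((hw t ht).const_mul (c m)) measurableSet_Ioi
      fun x hx => ?_
    rw [norm_mul, Real.norm_eq_abs, Real.norm_eq_abs, Real.abs_exp, ← mul_assoc]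
    exact mul_le_mul_of_nonneg_right (hb m x hx) (Real.exp_pos _).le

theorem laplaceConvergent_tsum {f : ℕ → ℝ → ℝ} {c : ℕ → ℝ} {w : ℝ → ℝ}
    (hf : ∀ m, Measurable (f m)) (hc : Summable c)
    (hw : LaplaceConvergent w) (hb : ∀ m x, 0 < x → |f m x| ≤ c m * w x) :
    LaplaceConvergent (fun x => ∑' m, f m x) := by
  refine (hw.const_mul (∑' m, c m)).mono (Measurable.aestronglyMeasurable ?_) fun x hx => ?_
  · exact Measurable.tsum hf
  · have h1 : ‖∑' m, f m x‖ ≤ ∑' m, c m * w x :=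
      tsum_of_norm_bounded (hc.mul_right (w x)).hasSum fun m => hb m x hx
    rw [tsum_mul_right] at h1
    exact h1.trans (le_abs_self _)

/-! ### Partial fractions over the poles of `1 / (e ^ x - 1)` -/

/-- The heights `2π, 4π, 6π, …` of the poles of `1 / (e ^ x - 1)` in the upper half-plane. -/
noncomputable def poleHeight (m : ℕ) : ℝ := 2 * π * (m + 1)

theorem one_le_poleHeight (m : ℕ) : 1 ≤ poleHeight m := by
  have h1 := Real.two_le_pi
  have h2 : (0 : ℝ) ≤ m := m.cast_nonneg
  rw [poleHeight]
  nlinarith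

theorem poleHeight_pos (m : ℕ) : 0 < poleHeight m := one_pos.trans_le (one_le_poleHeight m)

/-- Euler's evaluation of the zeta function at even integers, in terms of the pole heights. -/
theorem hasSum_inv_poleHeight_pow {i : ℕ} (hi : i ≠ 0) :
    HasSum (fun m => (poleHeight m ^ (2 * i))⁻¹)
      ((-1) ^ (i + 1) * (bernoulli (2 * i) : ℝ) / (2 * (2 * i).factorial)) := by
  have h := ((hasSum_nat_add_iff' 1).2 (hasSum_zeta_nat hi)).mul_left ((2 * π) ^ (2 * i))⁻¹
  have h0 : 2 * i ≠ 0 := by omega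
  convert! h using 1
  · ext m
    rw [poleHeight, mul_pow _ ((m : ℝ) + 1), mul_inv]
    push_cast
    rw [one_div]
  · have h2 : (2 : ℝ) ^ (2 * i) = 2 * 2 ^ (2 * i - 1) := by
      rw [← pow_succ']
      congr 1
      omega
    simp only [Finset.range_one, Finset.sum_singleton, Nat.cast_zero, zero_pow h0, div_zero,
      sub_zero, mul_pow, h2]
    have hpi := Real.pi_ne_zero
    field_simp

theorem summable_inv_poleHeight_sq : Summable fun m => (poleHeight m ^ 2)⁻¹ :=
  (hasSum_inv_poleHeight_pow one_ne_zero).summable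

/-- The real part of `(x + i a) ^ (-(k + 1))`. Multiplied by `(-1) ^ k * k!`, it is the `k`-th
derivative in `x` of `x / (x ^ 2 + a ^ 2)`. -/
noncomputable def poleKernel (k : ℕ) (a x : ℝ) : ℝ := ((((x : ℂ) + a * Complex.I) ^ (k + 1))⁻¹).re

theorem poleKernel_base_ne_zero {a : ℝ} (ha : 0 < a) (x : ℝ) : (x : ℂ) + a * Complex.I ≠ 0 := by
  intro h
  have := congrArg Complex.im h
  simp at this
  exact ha.ne' this

theorem hasDerivAt_poleKernel (k : ℕ) {a : ℝ} (ha : 0 < a) (x : ℝ) :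
    HasDerivAt (poleKernel k a) (-((k + 1) * poleKernel (k + 1) a x)) x := by
  have hne := poleKernel_base_ne_zero ha x
  have h1 : HasDerivAt (fun z : ℂ => z + a * Complex.I) 1 (x : ℂ) :=
    (hasDerivAt_id _).add_const _
  have h2 := ((h1.pow (k + 1)).inv (pow_ne_zero _ hne)).real_of_complex
  refine h2.congr_deriv ?_
  have h3 : -(((k + 1 : ℕ) : ℂ) * ((x : ℂ) + a * Complex.I) ^ (k + 1 - 1) * 1) /
      (((x : ℂ) + a * Complex.I) ^ (k + 1)) ^ 2
      = ((-(k + 1) : ℝ) : ℂ) * (((x : ℂ) + a * Complex.I) ^ (k + 1 + 1))⁻¹ := by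
    rw [Nat.add_sub_cancel]
    push_cast
    field_simp
    ring
  simp only [Pi.pow_apply]
  rw [h3, Complex.re_ofReal_mul, poleKernel]
  ring

theorem continuous_poleKernel (k : ℕ) {a : ℝ} (ha : 0 < a) : Continuous (poleKernel k a) :=
  continuous_iff_continuousAt.2 fun x => (hasDerivAt_poleKernel k ha x).continuousAt

theorem norm_inv_pow_le {a : ℝ} (ha : 0 < a) (k : ℕ) (x : ℝ) :
    ‖(((x : ℂ) + a * Complex.I) ^ k)⁻¹‖ ≤ (a ^ k)⁻¹ := by
  rw [norm_inv, norm_pow]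
  refine inv_anti₀ (by positivity) (pow_le_pow_left₀ ha.le ?_ _)
  have := Complex.abs_im_le_norm ((x : ℂ) + a * Complex.I)
  simpa [abs_of_pos ha] using this

theorem abs_poleKernel_le (k : ℕ) {a : ℝ} (ha : 0 < a) (x : ℝ) :
    |poleKernel k a x| ≤ (a ^ (k + 1))⁻¹ :=
  (Complex.abs_re_le_norm _).trans (norm_inv_pow_le ha _ x)

theorem poleKernel_zero (a x : ℝ) : poleKernel 0 a x = x / (x ^ 2 + a ^ 2) := by
  simp [poleKernel, Complex.inv_re, Complex.normSq_apply, sq]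

theorem poleKernel_even_apply_zero (i : ℕ) (a : ℝ) : poleKernel (2 * i) a 0 = 0 := by
  have h : ((0 : ℝ) + (a : ℂ) * Complex.I) ^ (2 * i + 1)
      = (((-1) ^ i * a ^ (2 * i + 1) : ℝ) : ℂ) * Complex.I := by
    rw [Complex.ofReal_zero, zero_add, mul_pow, pow_succ Complex.I, pow_mul Complex.I, Complex.I_sq]
    push_cast
    ring
  rw [poleKernel, h, mul_inv, ← Complex.ofReal_inv, Complex.re_ofReal_mul, Complex.inv_I]
  simp

theorem poleKernel_odd_apply_zero (i : ℕ) (a : ℝ) :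
    poleKernel (2 * i + 1) a 0 = (-1) ^ (i + 1) * (a ^ (2 * (i + 1)))⁻¹ := by
  have h : ((0 : ℝ) + (a : ℂ) * Complex.I) ^ (2 * i + 1 + 1)
      = (((-1) ^ (i + 1) * a ^ (2 * (i + 1)) : ℝ) : ℂ) := by
    rw [Complex.ofReal_zero, zero_add, mul_pow, show 2 * i + 1 + 1 = 2 * (i + 1) by ring,
      pow_mul Complex.I, Complex.I_sq]
    push_cast
    ring
  rw [poleKernel, h, ← Complex.ofReal_inv, Complex.ofReal_re, mul_inv, ← inv_pow (-1 : ℝ)]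
  norm_num

/-- A bound for the kernels that is uniform in the order and summable over the pole heights. -/
theorem abs_two_mul_poleKernel_le (k m : ℕ) {x : ℝ} (hx : 0 < x) :
    |2 * poleKernel k (poleHeight m) x| ≤ (poleHeight m ^ 2)⁻¹ * (2 + 2 * x) := by
  have ha := poleHeight_pos m
  have ha1 := one_le_poleHeight m
  have hi : 0 < (poleHeight m ^ 2)⁻¹ := by positivity
  rw [abs_mul, abs_two]
  rcases k with _ | k
  · have h : |poleKernel 0 (poleHeight m) x| ≤ (poleHeight m ^ 2)⁻¹ * x := by
      rw [poleKernel_zero, abs_of_nonneg (by positivity), div_eq_inv_mul]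
      exact mul_le_mul_of_nonneg_right (inv_anti₀ (by positivity) (by nlinarith)) hx.le
    nlinarith
  · have h : |poleKernel (k + 1) (poleHeight m) x| ≤ (poleHeight m ^ 2)⁻¹ :=
      (abs_poleKernel_le _ ha x).trans
        (inv_anti₀ (by positivity) (pow_le_pow_right₀ ha1 (by omega)))
    nlinarith

/-- The sum of the kernels of order `k` over all poles of `1 / (e ^ x - 1)` except the origin. -/
noncomputable def poleDensity (k : ℕ) (x : ℝ) : ℝ := ∑' m, 2 * poleKernel k (poleHeight m) x

theorem laplaceConvergent_two_add : LaplaceConvergent (fun x => 2 + 2 * x) :=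
  (LaplaceConvergent.const 2).add (((LaplaceConvergent.const 2).id_mul).congr fun x _ => by ring)

theorem hasSum_poleDensity (k : ℕ) {x : ℝ} (hx : 0 < x) :
    HasSum (fun m => 2 * poleKernel k (poleHeight m) x) (poleDensity k x) :=
  ((summable_inv_poleHeight_sq.mul_right (2 + 2 * x)).of_norm_bounded
    fun m => abs_two_mul_poleKernel_le k m hx).hasSum

theorem laplaceConvergent_poleDensity (k : ℕ) : LaplaceConvergent (poleDensity k) :=
  laplaceConvergent_tsum
    (fun m => (continuous_const.mul (continuous_poleKernel k (poleHeight_pos m))).measurable)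
    summable_inv_poleHeight_sq laplaceConvergent_two_add
    fun m _ hx => abs_two_mul_poleKernel_le k m hx

theorem hasSum_laplace_poleKernel (k : ℕ) {t : ℝ} (ht : 0 < t) :
    HasSum (fun m => 2 * laplace (poleKernel k (poleHeight m)) t) (laplace (poleDensity k) t) := by
  simp only [← laplace_const_mul]
  exact hasSum_laplace
    (fun m => (continuous_const.mul
      (continuous_poleKernel k (poleHeight_pos m))).aestronglyMeasurable)
    summable_inv_poleHeight_sq laplaceConvergent_two_add
    (fun m _ hx => abs_two_mul_poleKernel_le k m hx) ht

theorem mul_laplace_poleDensity {k : ℕ} {z : ℝ}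
    (hz : HasSum (fun m => 2 * poleKernel k (poleHeight m) 0) z) {t : ℝ} (ht : 0 < t) :
    t * laplace (poleDensity k) t = z - (k + 1) * laplace (poleDensity (k + 1)) t := by
  refine ((hasSum_laplace_poleKernel k ht).mul_left t).unique ?_
  refine (hz.sub ((hasSum_laplace_poleKernel (k + 1) ht).mul_left ((k : ℝ) + 1))).congr_fun
    fun m => ?_
  have ha := poleHeight_pos m
  have h := mul_laplace_eq (hasDerivAt_poleKernel k ha) (fun x _ => abs_poleKernel_le k ha x)
    (((LaplaceConvergent.of_bound (continuous_poleKernel (k + 1) ha).aestronglyMeasurable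
      fun x _ => abs_poleKernel_le (k + 1) ha x).const_mul (-((k : ℝ) + 1))).congr
        fun x _ => (neg_mul _ _).symm) ht
  simp only [← neg_mul] at h
  rw [laplace_const_mul] at h
  linear_combination 2 * h

theorem hasSum_poleKernel_odd_apply_zero (i : ℕ) :
    HasSum (fun m => 2 * poleKernel (2 * i + 1) (poleHeight m) 0)
      (-((bernoulli (2 * (i + 1)) : ℝ) / (2 * (i + 1)).factorial)) := by
  have h := (hasSum_inv_poleHeight_pow i.succ_ne_zero).mul_left (2 * (-1) ^ (i + 1))
  have hs : ((-1 : ℝ) ^ (i + 1)) * (-1) ^ (i + 1) = 1 := by rw [← mul_pow]; norm_num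
  convert! h using 1
  · ext m
    rw [poleKernel_odd_apply_zero]
    simp only [Nat.succ_eq_add_one]
    ring
  · simp only [Nat.succ_eq_add_one]
    rw [pow_succ (-1 : ℝ) (i + 1)]
    field_simp
    linear_combination (bernoulli (2 * (i + 1)) : ℝ) * hs

theorem mul_laplace_poleDensity_even (i : ℕ) {t : ℝ} (ht : 0 < t) :
    t * laplace (poleDensity (2 * i)) t
      = -((2 * i + 1) * laplace (poleDensity (2 * i + 1)) t) := by
  have hz : HasSum (fun m => 2 * poleKernel (2 * i) (poleHeight m) 0) 0 := by
    simp only [poleKernel_even_apply_zero, mul_zero]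
    exact hasSum_zero
  have := mul_laplace_poleDensity hz ht
  push_cast at this
  linarith

theorem mul_laplace_poleDensity_odd (i : ℕ) {t : ℝ} (ht : 0 < t) :
    t * laplace (poleDensity (2 * i + 1)) t
      = -((bernoulli (2 * (i + 1)) : ℝ) / (2 * (i + 1)).factorial)
        - (2 * i + 2) * laplace (poleDensity (2 * (i + 1))) t := by
  have := mul_laplace_poleDensity (hasSum_poleKernel_odd_apply_zero i) ht
  push_cast at this
  rw [this, show 2 * i + 1 + 1 = 2 * (i + 1) by ring]
  ring

/-- Repeated integration by parts turns the boundary terms at the origin into the terms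
`B_{2k} / (2k t ^ {2k})` of the asymptotic expansion. -/
theorem pow_mul_laplace_poleDensity_sub (n : ℕ) {t : ℝ} (ht : 0 < t) :
    t ^ (2 * n) * (laplace (poleDensity 0) t - ∑ k ∈ Finset.Icc 1 n,
        ((bernoulli (2 * k) : ℚ) : ℝ) / (2 * (k : ℝ)) * (1 / t ^ (2 * k)))
      = (2 * n).factorial * laplace (poleDensity (2 * n)) t := by
  induction n with
  | zero => simp
  | succ n ih =>
    rw [Finset.sum_Icc_succ_top (by omega), ← sub_sub, mul_sub]
    have h1 : t ^ (2 * (n + 1)) * (((bernoulli (2 * (n + 1)) : ℚ) : ℝ) / (2 * ((n + 1 : ℕ) : ℝ))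
        * (1 / t ^ (2 * (n + 1)))) = (bernoulli (2 * (n + 1)) : ℝ) / (2 * n + 2) := by
      push_cast
      field_simp
    have hf : ((2 * (n + 1)).factorial : ℝ)
        = (2 * n + 2) * ((2 * n + 1) * (2 * n).factorial) := by
      rw [show 2 * (n + 1) = 2 * n + 1 + 1 by ring, Nat.factorial_succ, Nat.factorial_succ]
      push_cast
      ring
    have h2 := mul_laplace_poleDensity_even n ht
    have h3 := mul_laplace_poleDensity_odd n ht
    have h5 : (2 * (n : ℝ) + 1) * (2 * n).factorial
        * ((bernoulli (2 * (n + 1)) : ℝ) / (2 * (n + 1)).factorial)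
        = (bernoulli (2 * (n + 1)) : ℝ) / (2 * n + 2) := by
      rw [hf]
      have : (2 * (n : ℝ) + 1) ≠ 0 := by positivity
      have : (2 * (n : ℝ) + 2) ≠ 0 := by positivity
      field_simp
    rw [h1, hf, show t ^ (2 * (n + 1)) = t ^ 2 * t ^ (2 * n) by ring, mul_assoc, ih]
    linear_combination ((2 * n).factorial : ℝ) * t * h2
      - ((2 * n).factorial : ℝ) * (2 * n + 1) * h3 + h5

/-- The transform left over after `2n - 1` integrations by parts has a density of constant sign,
as the modulus of each kernel is largest at the origin. -/
theorem isCompletelyMonotonic_laplace_poleDensity_div (i : ℕ) :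
    IsCompletelyMonotonic
      (fun t => (-1) ^ (i + 1) * (laplace (poleDensity (2 * (i + 1))) t / t)) := by
  set z := -((bernoulli (2 * (i + 1)) : ℝ) / (2 * (i + 1)).factorial)
  have hc : LaplaceConvergent fun x => (-1) ^ (i + 1) * (z - poleDensity (2 * i + 1) x) :=
    ((LaplaceConvergent.const z).sub (laplaceConvergent_poleDensity _)).const_mul _
  have hcm := (hc.isCompletelyMonotonic fun x hx => ?_).const_mul
    (c := (2 * (i : ℝ) + 2)⁻¹) (by positivity)
  · refine hcm.congr fun t ht => ?_
    rw [laplace_const_mul, (LaplaceConvergent.const z).laplace_sub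
      (laplaceConvergent_poleDensity _) ht, laplace_const z ht]
    have h := mul_laplace_poleDensity_odd i ht
    have h2 : (2 * (i : ℝ) + 2) ≠ 0 := by positivity
    field_simp
    linear_combination h
  · have h1 := ((hasSum_poleKernel_odd_apply_zero i).sub
      (hasSum_poleDensity (2 * i + 1) hx)).mul_left ((-1) ^ (i + 1))
    refine h1.nonneg fun m => ?_
    rw [poleKernel_odd_apply_zero]
    have ha := poleHeight_pos m
    have h2 := abs_poleKernel_le (2 * i + 1) ha x
    have h3 : |(-1) ^ (i + 1) * poleKernel (2 * i + 1) (poleHeight m) x|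
        ≤ (poleHeight m ^ (2 * (i + 1)))⁻¹ := by
      rw [abs_mul, abs_pow, abs_neg, abs_one, one_pow, one_mul]
      exact h2
    have h4 := (abs_le.1 h3).2
    have hs : ((-1 : ℝ) ^ (i + 1)) * (-1) ^ (i + 1) = 1 := by rw [← mul_pow]; norm_num
    have h5 : (-1 : ℝ) ^ (i + 1) * (2 * ((-1) ^ (i + 1) * (poleHeight m ^ (2 * (i + 1)))⁻¹)
        - 2 * poleKernel (2 * i + 1) (poleHeight m) x)
        = 2 * ((poleHeight m ^ (2 * (i + 1)))⁻¹
          - (-1) ^ (i + 1) * poleKernel (2 * i + 1) (poleHeight m) x) := by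
      linear_combination 2 * (poleHeight m ^ (2 * (i + 1)))⁻¹ * hs
    rw [h5]
    linarith

/-! ### Closed forms of the low-order pole sums -/

/-- The point `i x / 2π` of the upper half-plane, at which the classical expansions of the
cotangent and of its derivatives are evaluated. -/
noncomputable def imagAxisPoint (x : ℝ) (hx : 0 < x) : UpperHalfPlane :=
  ⟨((x / (2 * π) : ℝ) : ℂ) * Complex.I, by
    rw [Complex.im_ofReal_mul, Complex.I_im, mul_one]
    positivity⟩

theorem coe_imagAxisPoint {x : ℝ} (hx : 0 < x) :
    (imagAxisPoint x hx : ℂ) = ((x / (2 * π) : ℝ) : ℂ) * Complex.I := rfl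

theorem exp_two_pi_I_mul_imagAxisPoint {x : ℝ} (hx : 0 < x) :
    Complex.exp (2 * π * Complex.I * imagAxisPoint x hx) = ((exp (-x) : ℝ) : ℂ) := by
  have hpi : (π : ℂ) ≠ 0 := by exact_mod_cast Real.pi_ne_zero
  rw [coe_imagAxisPoint, Complex.ofReal_exp]
  congr 1
  push_cast
  field_simp
  rw [Complex.I_sq]
  ring

/-- The Lipschitz formula on the imaginary axis: the sum of `(x + 2πi n) ^ (-(k + 1))` over all
integers `n` is `∑ n ^ k e ^ {-nx} / k!`. -/
theorem poleDensity_add_inv_pow {k : ℕ} (hk : 1 ≤ k) {x : ℝ} (hx : 0 < x) :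
    poleDensity k x + 1 / x ^ (k + 1) = (∑' n : ℕ, (n : ℝ) ^ k * exp (-x) ^ n) / k.factorial := by
  set f : ℤ → ℂ := fun n => 1 / ((imagAxisPoint x hx : ℂ) + n) ^ (k + 1) with hf
  set c : ℂ := (-2 * π * Complex.I) ^ (k + 1) with hcdef
  have hpi : (π : ℂ) ≠ 0 := by exact_mod_cast Real.pi_ne_zero
  have hc : c ≠ 0 := pow_ne_zero _ (by simp [Real.pi_ne_zero])
  have hfn : ∀ n : ℤ, f n = c * (((x : ℂ) - ((2 * π * n : ℝ) : ℂ) * Complex.I) ^ (k + 1))⁻¹ := by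
    intro n
    have h1 : (x : ℂ) - ((2 * π * n : ℝ) : ℂ) * Complex.I
        = (-2 * π * Complex.I) * ((imagAxisPoint x hx : ℂ) + n) := by
      rw [coe_imagAxisPoint]
      push_cast
      field_simp
      linear_combination (x : ℂ) * Complex.I_sq
    rw [h1, mul_pow, mul_inv, ← hcdef, ← mul_assoc, mul_inv_cancel₀ hc, one_mul]
    exact one_div _
  have hbd : ∀ m : ℕ, (poleHeight m ^ (k + 1))⁻¹ ≤ (poleHeight m ^ 2)⁻¹ := fun m =>
    inv_anti₀ (pow_pos (poleHeight_pos m) 2) (pow_le_pow_right₀ (one_le_poleHeight m) (by omega))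
  have hp : ∀ m : ℕ, f (-((m : ℤ) + 1))
      = c * (((x : ℂ) + poleHeight m * Complex.I) ^ (k + 1))⁻¹ := fun m => by
    rw [hfn, poleHeight]
    congr 4
    push_cast
    ring
  have hq : ∀ m : ℕ, f ((m : ℤ) + 1)
      = c * (starRingEnd ℂ) (((x : ℂ) + poleHeight m * Complex.I) ^ (k + 1))⁻¹ := fun m => by
    rw [hfn, poleHeight, map_inv₀, map_pow, map_add, map_mul, Complex.conj_ofReal,
      Complex.conj_ofReal, Complex.conj_I]
    congr 4
    push_cast
    ring
  have hsum : Summable fun m : ℕ => (((x : ℂ) + poleHeight m * Complex.I) ^ (k + 1))⁻¹ :=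
    summable_inv_poleHeight_sq.of_norm_bounded
      fun m => (norm_inv_pow_le (poleHeight_pos m) _ x).trans (hbd m)
  have hsum' : Summable fun m : ℕ =>
      (starRingEnd ℂ) (((x : ℂ) + poleHeight m * Complex.I) ^ (k + 1))⁻¹ :=
    summable_inv_poleHeight_sq.of_norm_bounded fun m => by
      rw [RCLike.norm_conj]
      exact (norm_inv_pow_le (poleHeight_pos m) _ x).trans (hbd m)
  have h1 : Summable fun m : ℕ => f ((m : ℤ) + 1) := by
    simp only [hq]; exact hsum'.mul_left c
  have h2 : Summable fun m : ℕ => f (-((m : ℤ) + 1)) := by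
    simp only [hp]; exact hsum.mul_left c
  have htot := tsum_of_add_one_of_neg_add_one h1 h2
  have hE := EisensteinSeries.qExpansion_identity hk (imagAxisPoint x hx)
  rw [exp_two_pi_I_mul_imagAxisPoint, htot] at hE
  have hz0 : f 0 = c * ((1 / x ^ (k + 1) : ℝ) : ℂ) := by
    rw [hfn]; push_cast; simp
  have hr : (∑' n : ℕ, (n : ℂ) ^ k * ((exp (-x) : ℝ) : ℂ) ^ n)
      = ((∑' n : ℕ, (n : ℝ) ^ k * exp (-x) ^ n : ℝ) : ℂ) := by
    push_cast
    rfl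
  simp only [hp, hq, hz0, tsum_mul_left, hr] at hE
  have hE2 : (∑' m : ℕ, (starRingEnd ℂ) (((x : ℂ) + poleHeight m * Complex.I) ^ (k + 1))⁻¹)
      + ((1 / x ^ (k + 1) : ℝ) : ℂ) + ∑' m : ℕ, (((x : ℂ) + poleHeight m * Complex.I) ^ (k + 1))⁻¹
      = (((∑' n : ℕ, (n : ℝ) ^ k * exp (-x) ^ n) / k.factorial : ℝ) : ℂ) := by
    apply mul_left_cancel₀ hc
    rw [mul_add, mul_add, hE]
    push_cast
    ring
  have hre := congrArg Complex.re hE2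
  rw [Complex.add_re, Complex.add_re, Complex.re_tsum hsum, Complex.re_tsum hsum',
    Complex.ofReal_re, Complex.ofReal_re] at hre
  simp only [Complex.conj_re] at hre
  rw [← hre, poleDensity, tsum_mul_left]
  simp only [poleKernel]
  ring

theorem poleDensity_one {x : ℝ} (hx : 0 < x) :
    poleDensity 1 x = exp (-x) / (1 - exp (-x)) ^ 2 - 1 / x ^ 2 := by
  have h := poleDensity_add_inv_pow le_rfl hx
  have hr : ‖exp (-x)‖ < 1 := by
    rw [Real.norm_eq_abs, Real.abs_exp]
    exact by simpa using hx
  simp only [pow_one, tsum_coe_mul_geometric_of_norm_lt_one hr, Nat.factorial_one, Nat.cast_one,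
    div_one] at h
  linarith

theorem poleDensity_two {x : ℝ} (hx : 0 < x) :
    poleDensity 2 x = exp (-x) * (1 + exp (-x)) / (2 * (1 - exp (-x)) ^ 3) - 1 / x ^ 3 := by
  have h := poleDensity_add_inv_pow one_le_two hx
  have hlt : exp (-x) < 1 := by simpa using hx
  have hr : ‖exp (-x)‖ < 1 := by
    rwa [Real.norm_eq_abs, Real.abs_exp]
  have hs : HasSum (fun n : ℕ => (n : ℝ) ^ 2 * exp (-x) ^ n)
      (exp (-x) * (1 + exp (-x)) / (1 - exp (-x)) ^ 3) := by
    have h2 := ((hasSum_choose_mul_geometric_of_norm_lt_one 2 hr).mul_left 2).sub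
      ((hasSum_coe_mul_geometric_of_norm_lt_one hr).mul_left 3) |>.sub
      ((hasSum_geometric_of_norm_lt_one hr).mul_left 2)
    convert! h2 using 1
    · ext n
      have : (((n + 2).choose 2 : ℕ) : ℝ) = (n + 2) * (n + 1) / 2 := by
        rw [Nat.cast_choose_two]
        push_cast
        ring
      rw [this]
      ring
    · have : 1 - exp (-x) ≠ 0 := (sub_pos.2 hlt).ne'
      field_simp
      ring
  rw [hs.tsum_eq] at h
  have h4 : exp (-x) * (1 + exp (-x)) / (2 * (1 - exp (-x)) ^ 3)
      = exp (-x) * (1 + exp (-x)) / (1 - exp (-x)) ^ 3 / (2 : ℕ).factorial := by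
    rw [Nat.factorial_two, Nat.cast_two, div_div, mul_comm (2 : ℝ)]
  rw [h4]
  linarith

/-- The partial fraction expansion of the cotangent on the imaginary axis. -/
theorem poleDensity_zero {x : ℝ} (hx : 0 < x) :
    poleDensity 0 x = 1 / (1 - exp (-x)) - 1 / 2 - 1 / x := by
  set z : ℂ := (imagAxisPoint x hx : ℂ) with hz
  have hpi : (π : ℂ) ≠ 0 := by exact_mod_cast Real.pi_ne_zero
  have hlt : exp (-x) < 1 := by simpa using hx
  have hr : ‖((exp (-x) : ℝ) : ℂ)‖ < 1 := by
    rwa [Complex.norm_real, Real.norm_eq_abs, Real.abs_exp]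
  have hmem : z ∈ Complex.integerComplement := (imagAxisPoint x hx).coe_mem_integerComplement
  have h1 := cot_series_rep' hmem
  rw [hz, pi_mul_cot_pi_q_exp, exp_two_pi_I_mul_imagAxisPoint, tsum_geometric_of_norm_lt_one hr]
    at h1
  have hterm : ∀ m : ℕ, 1 / ((imagAxisPoint x hx : ℂ) - (m + 1))
      + 1 / ((imagAxisPoint x hx : ℂ) + (m + 1))
      = (-2 * π * Complex.I) * ((2 * poleKernel 0 (poleHeight m) x : ℝ) : ℂ) := by
    intro m
    have ha := poleHeight_pos m
    have hb1 := poleKernel_base_ne_zero ha x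
    have hb2 : (x : ℂ) - poleHeight m * Complex.I ≠ 0 := by
      have := (map_ne_zero (starRingEnd ℂ)).2 hb1
      rw [map_add, map_mul, Complex.conj_ofReal, Complex.conj_ofReal, Complex.conj_I] at this
      simpa [sub_eq_add_neg] using this
    have hc : (-2 * π * Complex.I) ≠ 0 := by simp [Real.pi_ne_zero]
    have e1 : (imagAxisPoint x hx : ℂ) - (m + 1)
        = (-2 * π * Complex.I)⁻¹ * ((x : ℂ) + poleHeight m * Complex.I) := by
      rw [eq_inv_mul_iff_mul_eq₀ hc, coe_imagAxisPoint, poleHeight]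
      push_cast
      field_simp
      linear_combination (-(x : ℂ)) * Complex.I_sq
    have e2 : (imagAxisPoint x hx : ℂ) + (m + 1)
        = (-2 * π * Complex.I)⁻¹ * ((x : ℂ) - poleHeight m * Complex.I) := by
      rw [eq_inv_mul_iff_mul_eq₀ hc, coe_imagAxisPoint, poleHeight]
      push_cast
      field_simp
      linear_combination (-(x : ℂ)) * Complex.I_sq
    have hq : ((x ^ 2 + poleHeight m ^ 2 : ℝ) : ℂ)
        = ((x : ℂ) + poleHeight m * Complex.I) * ((x : ℂ) - poleHeight m * Complex.I) := by
      push_cast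
      linear_combination (poleHeight m : ℂ) ^ 2 * Complex.I_sq
    have hs : ((x : ℂ) + poleHeight m * Complex.I) + ((x : ℂ) - poleHeight m * Complex.I)
        = 2 * x := by ring
    rw [e1, e2, poleKernel_zero, Complex.ofReal_mul, Complex.ofReal_div, hq, Complex.ofReal_ofNat]
    generalize (x : ℂ) + poleHeight m * Complex.I = u at *
    generalize (x : ℂ) - poleHeight m * Complex.I = v at *
    generalize -2 * (π : ℂ) * Complex.I = c at *
    rw [one_div, one_div, mul_inv, mul_inv, inv_inv, ← mul_add, mul_div_assoc', ← hs]
    congr 1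
    field_simp
    ring
  simp only [hterm] at h1
  rw [tsum_mul_left, ← Complex.ofReal_tsum] at h1
  have h2 : (-2 * π * Complex.I) * (((1 / (1 - exp (-x)) - 1 / 2 - 1 / x : ℝ)) : ℂ)
      = (-2 * π * Complex.I) * ((poleDensity 0 x : ℝ) : ℂ) := by
    rw [poleDensity, ← h1, coe_imagAxisPoint]
    push_cast
    have : (1 : ℂ) - Complex.exp (-x) ≠ 0 := by
      have := (sub_pos.2 hlt).ne'
      intro h
      apply this
      exact_mod_cast h
    field_simp
    rw [Complex.I_sq]
    ring
  have hc : (-2 * π * Complex.I) ≠ 0 := by simp [Real.pi_ne_zero]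
  exact (Complex.ofReal_injective (mul_left_cancel₀ hc h2)).symm

/-! ### Signs of the low-order pole sums -/

theorem one_sub_exp_neg_eq (y : ℝ) : 1 - exp (-(2 * y)) = 2 * sinh y * exp (-y) := by
  have h1 : exp (-(2 * y)) = exp (-y) * exp (-y) := by rw [← Real.exp_add]; ring_nf
  have h2 : exp y * exp (-y) = 1 := by rw [← Real.exp_add]; simp
  rw [h1, Real.sinh_eq]
  linear_combination (-1 : ℝ) * h2

theorem one_add_exp_neg_eq (y : ℝ) : 1 + exp (-(2 * y)) = 2 * cosh y * exp (-y) := by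
  have h1 : exp (-(2 * y)) = exp (-y) * exp (-y) := by rw [← Real.exp_add]; ring_nf
  have h2 : exp y * exp (-y) = 1 := by rw [← Real.exp_add]; simp
  rw [h1, Real.cosh_eq]
  linear_combination (-1 : ℝ) * h2

/-- The classical inequality `cosh y ≤ (sinh y / y) ^ 3`: the function `sinh y / cosh y ^ (1/3)` has
derivative at least `1`. -/
theorem pow_three_mul_cosh_le {y : ℝ} (hy : 0 ≤ y) : y ^ 3 * cosh y ≤ sinh y ^ 3 := by
  have hd : ∀ s : ℝ, HasDerivAt (fun s => sinh s * cosh s ^ (-(1 / 3) : ℝ) - s)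
      (cosh s * cosh s ^ (-(1 / 3) : ℝ)
        + sinh s * (sinh s * (-(1 / 3)) * cosh s ^ (-(1 / 3) - 1 : ℝ)) - 1) s := fun s =>
    ((Real.hasDerivAt_sinh s).mul ((Real.hasDerivAt_cosh s).rpow_const
      (Or.inl (Real.cosh_pos s).ne'))).sub (hasDerivAt_id s)
  have hmono : Monotone (fun s => sinh s * cosh s ^ (-(1 / 3) : ℝ) - s) := by
    refine monotone_of_deriv_nonneg (fun s => (hd s).differentiableAt) fun s => ?_
    rw [(hd s).deriv]
    have hc := Real.cosh_pos s
    set w := cosh s ^ (-(1 / 3) : ℝ) with hw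
    have hw0 : 0 < w := Real.rpow_pos_of_pos hc _
    have hw3 : w ^ 3 * cosh s = 1 := by
      rw [hw, ← Real.rpow_natCast, ← Real.rpow_mul hc.le]
      norm_num [Real.rpow_neg_one]
      exact inv_mul_cancel₀ hc.ne'
    have hw4 : cosh s ^ (-(1 / 3) - 1 : ℝ) = w ^ 4 := by
      rw [hw, ← Real.rpow_natCast, ← Real.rpow_mul hc.le]
      norm_num
    have hsq : sinh s ^ 2 = cosh s ^ 2 - 1 := Real.sinh_sq s
    rw [hw4]
    -- in terms of `w = cosh ^ (-1/3)` the derivative is `(1 - w²)² (2 + w²) / (3w²)`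
    have hkey : cosh s * w + sinh s * (sinh s * (-(1 / 3)) * w ^ 4) - 1
        = (1 - w ^ 2) ^ 2 * (2 + w ^ 2) / (3 * w ^ 2) := by
      have hcw : cosh s = 1 / w ^ 3 := by
        field_simp
        linarith
      have : sinh s * (sinh s * (-(1 / 3)) * w ^ 4) = -(1 / 3) * sinh s ^ 2 * w ^ 4 := by ring
      rw [this, hsq, hcw]
      field_simp
      ring
    rw [hkey]
    positivity
  have h0 := hmono hy
  simp only [Real.sinh_zero, zero_mul, sub_zero] at h0
  have hc := Real.cosh_pos y
  have h1 : y ≤ sinh y * cosh y ^ (-(1 / 3) : ℝ) := by linarith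
  have hw3 : (cosh y ^ (-(1 / 3) : ℝ)) ^ 3 * cosh y = 1 := by
    rw [← Real.rpow_natCast, ← Real.rpow_mul hc.le]
    norm_num [Real.rpow_neg_one]
    exact inv_mul_cancel₀ hc.ne'
  calc y ^ 3 * cosh y ≤ (sinh y * cosh y ^ (-(1 / 3) : ℝ)) ^ 3 * cosh y :=
        mul_le_mul_of_nonneg_right (pow_le_pow_left₀ hy h1 3) hc.le
    _ = sinh y ^ 3 * ((cosh y ^ (-(1 / 3) : ℝ)) ^ 3 * cosh y) := by ring
    _ = sinh y ^ 3 := by rw [hw3, mul_one]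

theorem poleDensity_one_nonpos {x : ℝ} (hx : 0 < x) : poleDensity 1 x ≤ 0 := by
  obtain ⟨y, rfl⟩ : ∃ y, x = 2 * y := ⟨x / 2, by ring⟩
  have hy : 0 < y := by linarith
  have hs : 0 < sinh y := Real.sinh_pos_iff.2 hy
  have he := Real.exp_pos (-y)
  have h1 : exp (-(2 * y)) = exp (-y) ^ 2 := by rw [← Real.exp_nat_mul]; ring_nf
  rw [poleDensity_one hx, one_sub_exp_neg_eq, h1, sub_nonpos, div_le_div_iff₀ (by positivity)
    (by positivity)]
  have h2 : y ≤ sinh y := Real.self_le_sinh_iff.2 hy.le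
  have h3 : y ^ 2 ≤ sinh y ^ 2 := pow_le_pow_left₀ hy.le h2 2
  calc exp (-y) ^ 2 * (2 * y) ^ 2 = 4 * exp (-y) ^ 2 * y ^ 2 := by ring
    _ ≤ 4 * exp (-y) ^ 2 * sinh y ^ 2 := mul_le_mul_of_nonneg_left h3 (by positivity)
    _ = _ := by ring

theorem poleDensity_two_nonpos {x : ℝ} (hx : 0 < x) : poleDensity 2 x ≤ 0 := by
  obtain ⟨y, rfl⟩ : ∃ y, x = 2 * y := ⟨x / 2, by ring⟩
  have hy : 0 < y := by linarith
  have hs : 0 < sinh y := Real.sinh_pos_iff.2 hy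
  have he := Real.exp_pos (-y)
  have h1 : exp (-(2 * y)) = exp (-y) ^ 2 := by rw [← Real.exp_nat_mul]; ring_nf
  rw [poleDensity_two hx, one_sub_exp_neg_eq, one_add_exp_neg_eq, h1, sub_nonpos,
    div_le_div_iff₀ (by positivity) (by positivity)]
  have h3 := pow_three_mul_cosh_le hy.le
  calc exp (-y) ^ 2 * (2 * cosh y * exp (-y)) * (2 * y) ^ 3
      = 16 * exp (-y) ^ 3 * (y ^ 3 * cosh y) := by ring
    _ ≤ 16 * exp (-y) ^ 3 * sinh y ^ 3 := mul_le_mul_of_nonneg_left h3 (by positivity)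
    _ = _ := by ring

/-! ### Binet's formula -/

/-- The density in Binet's formula, in its partial fraction form. -/
noncomputable def binetDensity (x : ℝ) : ℝ := ∑' m, 2 / (x ^ 2 + poleHeight m ^ 2)

/-- Binet's function, the Laplace transform of `binetDensity`; it is the error term in Stirling's
formula (`log_Gamma_eq_binet`). -/
noncomputable def binet : ℝ → ℝ := laplace binetDensity

theorem sq_add_poleHeight_sq_pos (x : ℝ) (m : ℕ) : 0 < x ^ 2 + poleHeight m ^ 2 := by
  have := poleHeight_pos m
  positivity

theorem continuous_binetTerm (m : ℕ) : Continuous fun x : ℝ => 2 / (x ^ 2 + poleHeight m ^ 2) :=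
  continuous_const.div (by fun_prop) fun x => (sq_add_poleHeight_sq_pos x m).ne'

theorem abs_binetTerm_le (m : ℕ) (x : ℝ) :
    |2 / (x ^ 2 + poleHeight m ^ 2)| ≤ (poleHeight m ^ 2)⁻¹ * 2 := by
  have ha := poleHeight_pos m
  rw [abs_of_nonneg (by positivity), div_eq_inv_mul]
  exact mul_le_mul_of_nonneg_right (inv_anti₀ (by positivity) (by nlinarith)) two_pos.le

theorem laplaceConvergent_binetDensity : LaplaceConvergent binetDensity :=
  laplaceConvergent_tsum (fun m => (continuous_binetTerm m).measurable)
    summable_inv_poleHeight_sq (.const 2) fun m x _ => abs_binetTerm_le m x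

theorem mul_binetDensity (x : ℝ) : x * binetDensity x = poleDensity 0 x := by
  rw [binetDensity, poleDensity, ← tsum_mul_left]
  congr 1
  ext m
  rw [poleKernel_zero]
  ring

theorem binetDensity_nonneg (x : ℝ) : 0 ≤ binetDensity x :=
  tsum_nonneg fun m => (div_pos two_pos (sq_add_poleHeight_sq_pos x m)).le

theorem poleDensity_zero_nonneg {x : ℝ} (hx : 0 < x) : 0 ≤ poleDensity 0 x :=
  mul_binetDensity x ▸ mul_nonneg hx.le (binetDensity_nonneg x)

theorem isCompletelyMonotonic_binet : IsCompletelyMonotonic binet :=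
  laplaceConvergent_binetDensity.isCompletelyMonotonic fun x _ => binetDensity_nonneg x

theorem isCompletelyMonotonic_laplace_poleDensity_zero :
    IsCompletelyMonotonic (laplace (poleDensity 0)) :=
  (laplaceConvergent_poleDensity 0).isCompletelyMonotonic fun _ hx => poleDensity_zero_nonneg hx

theorem hasDerivAt_binet {t : ℝ} (ht : 0 < t) :
    HasDerivAt binet (-laplace (poleDensity 0) t) t := by
  refine (laplaceConvergent_binetDensity.hasDerivAt ht).congr_deriv ?_
  rw [laplace_congr fun x _ => mul_binetDensity x]

/-- One integration by parts: `1/12` is the sum of `2 / a ^ 2` over the pole heights `a`, and the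
remaining density is the sum of the positive functions `4x / (x ^ 2 + a ^ 2) ^ 2`. -/
theorem isCompletelyMonotonic_sub_mul_binet :
    IsCompletelyMonotonic (fun t => 1 / 12 - t * binet t) := by
  set g : ℕ → ℝ → ℝ := fun m x => 4 * x / (x ^ 2 + poleHeight m ^ 2) ^ 2 with hg
  have hgc : ∀ m, Continuous (g m) := fun m => Continuous.div (by fun_prop) (by fun_prop)
    fun x => pow_ne_zero 2 (sq_add_poleHeight_sq_pos x m).ne'
  have hgb : ∀ m x, 0 < x → |g m x| ≤ (poleHeight m ^ 2)⁻¹ * 2 := by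
    intro m x hx
    have ha1 := one_le_poleHeight m
    have ha := poleHeight_pos m
    rw [hg, abs_of_nonneg (by positivity), ← div_eq_inv_mul, div_le_div_iff₀ (by positivity)
      (by positivity)]
    have h1 : 2 * x ≤ x ^ 2 + poleHeight m ^ 2 := by nlinarith [sq_nonneg (x - 1)]
    have h2 : poleHeight m ^ 2 ≤ x ^ 2 + poleHeight m ^ 2 := by nlinarith
    nlinarith [mul_le_mul h1 h2 (by positivity) (by positivity)]
  have hgL : ∀ m, LaplaceConvergent (g m) := fun m =>
    .of_bound (hgc m).aestronglyMeasurable (hgb m)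
  have hL : LaplaceConvergent fun x => ∑' m, g m x :=
    laplaceConvergent_tsum (fun m => (hgc m).measurable) summable_inv_poleHeight_sq (.const 2) hgb
  have hcm := hL.isCompletelyMonotonic fun x hx => tsum_nonneg fun m =>
    (by rw [hg]; positivity : 0 ≤ g m x)
  refine hcm.congr fun t ht => ?_
  have h1 : HasSum (fun m => 2 * (poleHeight m ^ 2)⁻¹) (1 / 12 : ℝ) := by
    convert! (hasSum_inv_poleHeight_pow one_ne_zero).mul_left 2 using 1
    rw [mul_one, bernoulli_two]
    norm_num
  have h2 := (hasSum_laplace (fun m => (continuous_binetTerm m).aestronglyMeasurable)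
    summable_inv_poleHeight_sq (.const 2) (fun m x _ => abs_binetTerm_le m x) ht).mul_left t
  have h3 := hasSum_laplace (fun m => (hgc m).aestronglyMeasurable)
    summable_inv_poleHeight_sq (.const 2) hgb ht
  refine ((h1.sub h2).unique ?_)
  refine h3.congr_fun fun m => ?_
  have hd : ∀ x, HasDerivAt (fun x : ℝ => 2 / (x ^ 2 + poleHeight m ^ 2)) (-1 * g m x) x := by
    intro x
    have hq := ((hasDerivAt_pow 2 x).add_const (poleHeight m ^ 2)).fun_inv
      (sq_add_poleHeight_sq_pos x m).ne'
    refine (hq.const_mul 2).congr_deriv ?_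
    rw [hg]
    simp
    ring
  have h := mul_laplace_eq hd (fun x _ => abs_binetTerm_le m x) ((hgL m).const_mul (-1)) ht
  rw [laplace_const_mul] at h
  rw [h]
  ring

theorem tendsto_binet_atTop : Tendsto binet atTop (𝓝 0) := by
  have hz : Tendsto (fun t : ℝ => 1 / 12 * t⁻¹) atTop (𝓝 0) := by
    simpa using tendsto_inv_atTop_zero.const_mul (1 / 12 : ℝ)
  refine tendsto_of_tendsto_of_tendsto_of_le_of_le' tendsto_const_nhds hz ?_ ?_
  · filter_upwards [eventually_gt_atTop 0] with t ht using isCompletelyMonotonic_binet.nonneg ht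
  · filter_upwards [eventually_gt_atTop 0] with t ht
    have := isCompletelyMonotonic_sub_mul_binet.nonneg ht
    rw [← div_eq_mul_inv, le_div_iff₀ ht]
    linarith

theorem isCompletelyMonotonic_mul_laplace_poleDensity_zero :
    IsCompletelyMonotonic (fun t => t * laplace (poleDensity 0) t) := by
  refine (((laplaceConvergent_poleDensity 1).const_mul (-1)).isCompletelyMonotonic
    fun x hx => ?_).congr fun t ht => ?_
  · have := poleDensity_one_nonpos hx
    linarith
  · have := mul_laplace_poleDensity_even 0 ht
    rw [laplace_const_mul]
    simpa using this

theorem tendsto_laplace_poleDensity_zero_atTop :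
    Tendsto (laplace (poleDensity 0)) atTop (𝓝 0) :=
  tendsto_zero_of_isCompletelyMonotonic_rpow_mul one_pos
    (isCompletelyMonotonic_mul_laplace_poleDensity_zero.congr fun t _ => by rw [Real.rpow_one])

/-- Multiplying the density by `1 - e ^ {-x}` leaves elementary functions, so the transform of
`x * poleDensity 0 x` satisfies an explicit difference equation. -/
theorem laplace_mul_poleDensity_sub {t : ℝ} (ht : 0 < t) :
    laplace (fun x => x * poleDensity 0 x) t - laplace (fun x => x * poleDensity 0 x) (t + 1)
      = 1 / 2 * (1 / t ^ 2) + 1 / 2 * (1 / (t + 1) ^ 2) - 1 / t + 1 / (t + 1) := by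
  have ht1 : 0 < t + 1 := by linarith
  have hL := (laplaceConvergent_poleDensity 0).id_mul
  have hone := LaplaceConvergent.const 1
  have hid : LaplaceConvergent fun x => x := hone.id_mul.congr fun x _ => (mul_one x).symm
  have h1 := (hid.const_mul (1 / 2))
  have h2 := ((hid.mul_exp_neg).const_mul (1 / 2))
  rw [← laplace_mul_exp_neg, ← hL.laplace_sub hL.mul_exp_neg ht, ← laplace_id ht,
    ← laplace_id ht1, ← laplace_const 1 ht, ← laplace_const 1 ht1, ← laplace_mul_exp_neg,
    ← laplace_mul_exp_neg, ← laplace_const_mul, ← laplace_const_mul, ← h1.laplace_add h2 ht,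
    ← (h1.add h2).laplace_sub hone ht, ← ((h1.add h2).sub hone).laplace_add hone.mul_exp_neg ht]
  refine laplace_congr (fun x hx => ?_) t
  have hlt : exp (-x) < 1 := by simpa using hx
  have hne : 1 - exp (-x) ≠ 0 := (sub_pos.2 hlt).ne'
  rw [poleDensity_zero hx]
  field_simp
  ring

theorem eq_zero_of_hasDerivAt_zero {f : ℝ → ℝ} (hf : ∀ t, 0 < t → HasDerivAt f 0 t)
    (hlim : Tendsto f atTop (𝓝 0)) {t : ℝ} (ht : 0 < t) : f t = 0 := by
  refine tendsto_nhds_unique (tendsto_const_nhds.congr' ?_) hlim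
  filter_upwards [eventually_gt_atTop 0] with s hs
  exact isOpen_Ioi.is_const_of_deriv_eq_zero isPreconnected_Ioi
    (fun u hu => (hf u hu).differentiableAt.differentiableWithinAt)
    (fun u hu => (hf u hu).deriv) (mem_Ioi.2 ht) (mem_Ioi.2 hs)

theorem tendsto_add_one_atTop : Tendsto (fun t : ℝ => t + 1) atTop atTop :=
  tendsto_atTop_add_const_right _ _ tendsto_id

theorem log_add_one_sub_log {t : ℝ} (ht : 0 < t) : log (t + 1) - log t = log (1 + 1 / t) := by
  rw [← Real.log_div (by linarith) ht.ne']
  congr 1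
  field_simp

theorem tendsto_log_add_one_sub_log : Tendsto (fun t => log (t + 1) - log t) atTop (𝓝 0) := by
  have h : Tendsto (fun t : ℝ => 1 + 1 / t) atTop (𝓝 1) := by
    simpa using tendsto_inv_atTop_zero.const_add (1 : ℝ)
  have h2 := (Real.continuousAt_log one_ne_zero).tendsto.comp h
  rw [Real.log_one] at h2
  refine h2.congr' ?_
  filter_upwards [eventually_gt_atTop 0] with t ht using (log_add_one_sub_log ht).symm

theorem laplace_poleDensity_zero_sub {t : ℝ} (ht : 0 < t) :
    laplace (poleDensity 0) t - laplace (poleDensity 0) (t + 1)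
      = 1 / 2 * (1 / t + 1 / (t + 1)) - (log (t + 1) - log t) := by
  have key := eq_zero_of_hasDerivAt_zero (f := fun t => laplace (poleDensity 0) t
    - laplace (poleDensity 0) (t + 1) - (1 / 2 * (t⁻¹ + (t + 1)⁻¹) - (log (t + 1) - log t)))
    (fun s hs => ?_) ?_ ht
  · simp only [one_div] at key ⊢
    linarith
  · have hs1 : 0 < s + 1 := by linarith
    have hadd : HasDerivAt (fun s : ℝ => s + 1) 1 s := (hasDerivAt_id s).add_const 1
    have h := (((laplaceConvergent_poleDensity 0).hasDerivAt hs).sub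
      (((laplaceConvergent_poleDensity 0).hasDerivAt hs1).comp_add_const s 1)).sub
      ((((hasDerivAt_inv hs.ne').add (hadd.fun_inv hs1.ne')).const_mul (1 / 2)).sub
        ((hadd.log hs1.ne').sub (Real.hasDerivAt_log hs.ne')))
    refine h.congr_deriv ?_
    have h2 := laplace_mul_poleDensity_sub hs
    simp only [one_div] at h2 ⊢
    rw [neg_div, one_div]
    linear_combination -h2
  · have h1 := tendsto_laplace_poleDensity_zero_atTop
    have h2 : Tendsto (fun t => laplace (poleDensity 0) (t + 1)) atTop (𝓝 0) :=
      h1.comp tendsto_add_one_atTop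
    have h3 : Tendsto (fun t : ℝ => t⁻¹) atTop (𝓝 0) := tendsto_inv_atTop_zero
    have h4 : Tendsto (fun t : ℝ => (t + 1)⁻¹) atTop (𝓝 0) := h3.comp tendsto_add_one_atTop
    have h5 := (h1.sub h2).sub (((h3.add h4).const_mul (1 / 2)).sub tendsto_log_add_one_sub_log)
    simp only [add_zero, mul_zero, sub_zero] at h5
    exact h5

/-- The difference equation of Binet's function, which is that of `log Γ`. -/
theorem binet_sub {t : ℝ} (ht : 0 < t) :
    binet t - binet (t + 1) = (t + 1 / 2) * (log (t + 1) - log t) - 1 := by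
  have key := eq_zero_of_hasDerivAt_zero (f := fun t => binet t - binet (t + 1)
    - ((t + 1 / 2) * (log (t + 1) - log t) - 1)) (fun s hs => ?_) ?_ ht
  · linarith
  · have hs1 : 0 < s + 1 := by linarith
    have hadd : HasDerivAt (fun s : ℝ => s + 1) 1 s := (hasDerivAt_id s).add_const 1
    have hhalf : HasDerivAt (fun s : ℝ => s + 1 / 2) 1 s := (hasDerivAt_id s).add_const _
    have h := ((hasDerivAt_binet hs).sub ((hasDerivAt_binet hs1).comp_add_const s 1)).sub
      ((hhalf.mul ((hadd.log hs1.ne').sub (Real.hasDerivAt_log hs.ne'))).sub_const 1)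
    refine h.congr_deriv ?_
    have h2 := laplace_poleDensity_zero_sub hs
    have h3 : (s + 1 / 2) * (1 / (s + 1) - s⁻¹) = -(1 / 2 * (1 / s + 1 / (s + 1))) := by
      field_simp
      ring
    simp only [Pi.sub_apply]
    rw [h3]
    linear_combination -h2
  · have h1 := tendsto_binet_atTop
    have h2 := h1.comp tendsto_add_one_atTop
    have h3 := Real.tendsto_mul_log_one_add_div_atTop 1
    have h4 := h3.add (tendsto_log_add_one_sub_log.const_mul (1 / 2))
    have h5 := (h1.sub h2).sub (h4.sub_const 1)
    simp only [mul_zero, add_zero, sub_self] at h5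
    refine h5.congr' ?_
    filter_upwards [eventually_gt_atTop 0] with t ht
    simp only [Function.comp_apply]
    rw [← log_add_one_sub_log ht]
    ring

/-- Stirling's formula with an undetermined constant, from the Bohr-Mollerup theorem. -/
theorem exists_log_Gamma_eq_binet_add_const :
    ∃ c, ∀ t, 0 < t → log (Gamma t) = (t - 1 / 2) * log t - t + binet t + c := by
  set c := 1 - binet 1 with hc
  set L : ℝ → ℝ := fun t => (t - 1 / 2) * log t - t + binet t + c with hL
  have hd : ∀ t, 0 < t → HasDerivAt L (log t - (2 * t)⁻¹ - laplace (poleDensity 0) t) t := by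
    intro t ht
    have hhalf : HasDerivAt (fun s : ℝ => s - 1 / 2) 1 t := (hasDerivAt_id t).sub_const _
    have h := (((hhalf.mul (Real.hasDerivAt_log ht.ne')).sub (hasDerivAt_id t)).add
      (hasDerivAt_binet ht)).add_const c
    refine h.congr_deriv ?_
    field_simp
    ring
  have hconv : ConvexOn ℝ (Ioi 0) L := by
    refine MonotoneOn.convexOn_of_deriv (convex_Ioi 0)
      (fun t ht => (hd t ht).continuousAt.continuousWithinAt) ?_ ?_
    · rw [interior_Ioi]
      exact fun t ht => (hd t ht).differentiableAt.differentiableWithinAt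
    · rw [interior_Ioi]
      intro s (hs : 0 < s) t (ht : 0 < t) hst
      rw [(hd s hs).deriv, (hd t ht).deriv]
      have h1 := Real.log_le_log hs hst
      have h2 : (2 * t)⁻¹ ≤ (2 * s)⁻¹ := inv_anti₀ (by positivity) (by linarith)
      have h3 := isCompletelyMonotonic_laplace_poleDensity_zero.antitoneOn hs ht hst
      linarith
  have h := Real.eq_Gamma_of_log_convex (f := fun t => exp (L t)) ?_ ?_ (fun _ => Real.exp_pos _) ?_
  · exact ⟨c, fun t ht => by rw [← h ht, Real.log_exp]⟩
  · exact hconv.congr fun t _ => by simp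
  · intro y hy
    have h2 := binet_sub hy
    have h3 : L (y + 1) = log y + L y := by
      rw [hL]
      linear_combination -h2
    simp only [h3, Real.exp_add, Real.exp_log hy]
  · simp only [hL, hc, Real.log_one, Real.exp_eq_one_iff]
    ring

/-- **Binet's formula** for `log Γ`. -/
theorem log_Gamma_eq_binet {t : ℝ} (ht : 0 < t) :
    log (Gamma t) = (t - 1 / 2) * log t - t + 1 / 2 * log (2 * π) + binet t := by
  obtain ⟨c, hc⟩ := exists_log_Gamma_eq_binet_add_const
  suffices h : c = 1 / 2 * log (2 * π) by
    rw [hc t ht, h]; ring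
  have h1 : Tendsto (fun n : ℕ => log (Stirling.stirlingSeq n)) atTop (𝓝 (log √π)) :=
    (Real.continuousAt_log (by positivity)).tendsto.comp Stirling.tendsto_stirlingSeq_sqrt_pi
  have h2 : Tendsto (fun n : ℕ => c - 1 / 2 * log 2 + binet n) atTop
      (𝓝 (c - 1 / 2 * log 2 + 0)) :=
    (tendsto_binet_atTop.comp tendsto_natCast_atTop_atTop).const_add _
  have h3 := tendsto_nhds_unique (h1.congr' ?_) h2
  · rw [Real.log_sqrt Real.pi_pos.le] at h3
    rw [Real.log_mul two_ne_zero Real.pi_ne_zero]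
    linarith
  · filter_upwards [eventually_gt_atTop 0] with n hn
    have hn0 : (0 : ℝ) < n := Nat.cast_pos.2 hn
    rw [Stirling.log_stirlingSeq_formula, ← Real.Gamma_nat_eq_factorial,
      Real.Gamma_add_one hn0.ne', Real.log_mul hn0.ne' (Real.Gamma_pos_of_pos hn0).ne', hc _ hn0,
      Real.log_mul two_ne_zero hn0.ne', Real.log_div hn0.ne' (Real.exp_pos 1).ne', Real.log_exp]
    ring

/-! ### Behaviour at the origin -/

theorem tendsto_mul_laplace_poleDensity_zero :
    Tendsto (fun t => t * laplace (poleDensity 0) t) (𝓝[>] 0) (𝓝 (1 / 2)) := by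
  have hid : Tendsto (fun t : ℝ => t) (𝓝[>] 0) (𝓝 0) := tendsto_id.mono_left nhdsWithin_le_nhds
  have h1 : ContinuousAt (fun t : ℝ => laplace (poleDensity 0) (t + 1)) 0 := by
    refine ContinuousAt.comp (g := laplace (poleDensity 0)) ?_ (by fun_prop)
    exact ((laplaceConvergent_poleDensity 0).hasDerivAt (by norm_num)).continuousAt
  have h2 : ContinuousAt (fun t : ℝ => log (t + 1)) 0 := by
    refine ContinuousAt.log (by fun_prop) (by norm_num)
  have h3 : ContinuousAt (fun t : ℝ => (t + 1)⁻¹) 0 :=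
    ContinuousAt.inv₀ (by fun_prop) (by norm_num)
  have h4 : Tendsto (fun t : ℝ => log t * t) (𝓝[>] 0) (𝓝 0) := by
    simpa using tendsto_log_mul_rpow_nhdsGT_zero one_pos
  have h5 := ((hid.mul (h1.tendsto.mono_left nhdsWithin_le_nhds)).sub
    (hid.mul (h2.tendsto.mono_left nhdsWithin_le_nhds))).add h4 |>.add
    (((hid.mul (h3.tendsto.mono_left nhdsWithin_le_nhds)).const_add 1).const_mul (1 / 2))
  simp only [zero_mul, sub_zero, add_zero, zero_add, mul_one] at h5
  refine h5.congr' ?_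
  filter_upwards [self_mem_nhdsWithin] with t ht
  have ht0 : t ≠ 0 := ne_of_gt ht
  have h := laplace_poleDensity_zero_sub ht
  rw [sub_eq_iff_eq_add] at h
  rw [h]
  field_simp
  ring

theorem tendsto_rpow_mul_binet {α : ℝ} (hα : 0 < α) :
    Tendsto (fun t => t ^ α * binet t) (𝓝[>] 0) (𝓝 0) := by
  have hid : Tendsto (fun t : ℝ => t) (𝓝[>] 0) (𝓝 0) := tendsto_id.mono_left nhdsWithin_le_nhds
  have hp : Tendsto (fun t : ℝ => t ^ α) (𝓝[>] 0) (𝓝 0) := by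
    have := (Real.continuousAt_rpow_const 0 α (Or.inr hα.le)).tendsto
    rw [Real.zero_rpow hα.ne'] at this
    exact this.mono_left nhdsWithin_le_nhds
  have h1 : ContinuousAt (fun t : ℝ => binet (t + 1)) 0 := by
    refine ContinuousAt.comp (g := binet) ?_ (by fun_prop)
    exact (hasDerivAt_binet (by norm_num)).continuousAt
  have h2 : ContinuousAt (fun t : ℝ => (t + 1 / 2) * log (t + 1)) 0 :=
    ContinuousAt.mul (by fun_prop) (ContinuousAt.log (by fun_prop) (by norm_num))
  have h4 : Tendsto (fun t : ℝ => log t * t ^ α) (𝓝[>] 0) (𝓝 0) :=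
    tendsto_log_mul_rpow_nhdsGT_zero hα
  have h3 : ContinuousAt (fun t : ℝ => binet (t + 1) + (t + 1 / 2) * log (t + 1) - 1) 0 :=
    (h1.add h2).sub continuousAt_const
  have h5 := (hp.mul (h3.tendsto.mono_left nhdsWithin_le_nhds)).sub
    ((hid.add_const (1 / 2)).mul h4)
  simp only [zero_mul, mul_zero, sub_zero] at h5
  refine h5.congr' ?_
  filter_upwards [self_mem_nhdsWithin] with t ht
  have h := binet_sub ht
  rw [sub_eq_iff_eq_add] at h
  rw [h]
  ring

/-- The function `laplace (poleDensity 0)` has order `t⁻¹` at the origin and the subtracted terms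
have order at most `t ^ (-2n)`, so the factor `t ^ (2n + 2)` outweighs both. -/
theorem tendsto_pow_succ_mul_laplace_sub (n : ℕ) :
    Tendsto (fun t => t ^ (2 * (n + 1)) * (laplace (poleDensity 0) t - ∑ k ∈ Finset.Icc 1 n,
        ((bernoulli (2 * k) : ℚ) : ℝ) / (2 * (k : ℝ)) * (1 / t ^ (2 * k)))) (𝓝[>] 0) (𝓝 0) := by
  have hid : Tendsto (fun t : ℝ => t) (𝓝[>] 0) (𝓝 0) := tendsto_id.mono_left nhdsWithin_le_nhds
  induction n with
  | zero =>
    have h := hid.mul tendsto_mul_laplace_poleDensity_zero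
    rw [zero_mul] at h
    refine h.congr fun t => ?_
    simp
    ring
  | succ n ih =>
    have h := (hid.mul hid).mul (ih.sub_const
      (((bernoulli (2 * (n + 1)) : ℚ) : ℝ) / (2 * ((n + 1 : ℕ) : ℝ))))
    simp only [zero_mul] at h
    refine h.congr' ?_
    filter_upwards [self_mem_nhdsWithin] with t ht
    have ht0 : t ≠ 0 := ne_of_gt ht
    rw [Finset.sum_Icc_succ_top (by omega)]
    have h1 : t ^ (2 * (n + 1 + 1)) * (((bernoulli (2 * (n + 1)) : ℚ) : ℝ)
        / (2 * ((n + 1 : ℕ) : ℝ)) * (1 / t ^ (2 * (n + 1))))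
        = t * t * (((bernoulli (2 * (n + 1)) : ℚ) : ℝ) / (2 * ((n + 1 : ℕ) : ℝ))) := by
      have : t ^ (2 * (n + 1 + 1)) = t * t * t ^ (2 * (n + 1)) := by ring
      rw [this]
      field_simp
    linear_combination h1

theorem bernoulli_two_mul_ne_zero {i : ℕ} (hi : i ≠ 0) : (bernoulli (2 * i) : ℝ) ≠ 0 := by
  intro h
  have hs := hasSum_inv_poleHeight_pow hi
  rw [h, mul_zero, zero_div] at hs
  have hpos : ∀ m, 0 < (poleHeight m ^ (2 * i))⁻¹ := fun m =>
    inv_pos.2 (pow_pos (poleHeight_pos m) _)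
  have := (hasSum_zero_iff_of_nonneg fun m => (hpos m).le).1 hs
  exact (hpos 0).ne' (congrFun this 0)

/-! ### The remainders in Stirling's expansion -/

theorem stirlingRemainder_eq_binet_sub (n : ℕ) {t : ℝ} (ht : 0 < t) :
    stirlingRemainder n t = (-1) ^ n * (binet t - ∑ k ∈ Finset.Icc 1 n,
      ((bernoulli (2 * k) : ℚ) : ℝ) / ((2 * (k : ℝ)) * (2 * (k : ℝ) - 1))
        * (1 / t ^ (2 * k - 1))) := by
  rw [stirlingRemainder, log_Gamma_eq_binet ht]
  ring

theorem stirlingRemainder_zero {t : ℝ} (ht : 0 < t) : stirlingRemainder 0 t = binet t := by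
  simp [stirlingRemainder_eq_binet_sub 0 ht]

theorem stirlingRemainder_one {t : ℝ} (ht : 0 < t) :
    stirlingRemainder 1 t = 1 / 12 * (1 / t) - binet t := by
  rw [stirlingRemainder_eq_binet_sub 1 ht]
  simp only [Finset.Icc_self, Finset.sum_singleton, mul_one, bernoulli_two]
  norm_num

theorem hasDerivAt_sum_stirling (n : ℕ) {t : ℝ} (ht : 0 < t) :
    HasDerivAt (fun t => ∑ k ∈ Finset.Icc 1 n,
        ((bernoulli (2 * k) : ℚ) : ℝ) / ((2 * (k : ℝ)) * (2 * (k : ℝ) - 1)) * (1 / t ^ (2 * k - 1)))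
      (-∑ k ∈ Finset.Icc 1 n, ((bernoulli (2 * k) : ℚ) : ℝ) / (2 * (k : ℝ)) * (1 / t ^ (2 * k)))
      t := by
  rw [← Finset.sum_neg_distrib]
  refine HasDerivAt.fun_sum fun k hk => ?_
  have hk1 : 1 ≤ k := (Finset.mem_Icc.1 hk).1
  obtain ⟨j, rfl⟩ : ∃ j, k = j + 1 := ⟨k - 1, by omega⟩
  have h := ((hasDerivAt_pow (2 * j + 1) t).fun_inv (pow_ne_zero _ ht.ne')).const_mul
    (((bernoulli (2 * (j + 1)) : ℚ) : ℝ) / ((2 * ((j + 1 : ℕ) : ℝ)) * (2 * ((j + 1 : ℕ) : ℝ) - 1)))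
  simp only [one_div, show 2 * (j + 1) - 1 = 2 * j + 1 by omega]
  refine h.congr_deriv ?_
  have h1 : (2 * ((j : ℝ) + 1) - 1) ≠ 0 := by
    have : (0 : ℝ) ≤ j := j.cast_nonneg
    linarith
  push_cast
  rw [show t ^ (2 * (j + 1)) = t ^ (2 * j + 1) * t by ring, show (2 * (j : ℝ) + 1)
    = 2 * ((j : ℝ) + 1) - 1 by ring]
  field_simp
  ring

theorem hasDerivAt_stirlingRemainder (n : ℕ) {t : ℝ} (ht : 0 < t) :
    HasDerivAt (stirlingRemainder n) (-((-1 : ℝ) ^ (n + 1) *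
      (digammaReal t - Real.log t + 1 / (2 * t)
        + ∑ k ∈ Finset.Icc 1 n,
            ((bernoulli (2 * k) : ℚ) : ℝ) / (2 * (k : ℝ)) * (1 / t ^ (2 * k))))) t := by
  have hG : HasDerivAt Gamma (deriv Gamma t) t := (Real.differentiableAt_Gamma fun m h => by
    have : (0 : ℝ) ≤ m := m.cast_nonneg
    linarith).hasDerivAt
  have hlG := hG.log (Real.Gamma_pos_of_pos ht).ne'
  have hhalf : HasDerivAt (fun s : ℝ => s - 1 / 2) 1 t := (hasDerivAt_id t).sub_const _
  have h := (((((hlG.sub (hhalf.mul (Real.hasDerivAt_log ht.ne'))).add (hasDerivAt_id t)).sub_const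
    (1 / 2 * log (2 * π))).sub (hasDerivAt_sum_stirling n ht)).const_mul ((-1) ^ n))
  refine h.congr_deriv ?_
  rw [digammaReal, pow_succ]
  field_simp
  ring

theorem neg_deriv_stirlingRemainder (n : ℕ) {t : ℝ} (ht : 0 < t) :
    -deriv (stirlingRemainder n) t = (-1) ^ n * (laplace (poleDensity 0) t
      - ∑ k ∈ Finset.Icc 1 n,
          ((bernoulli (2 * k) : ℚ) : ℝ) / (2 * (k : ℝ)) * (1 / t ^ (2 * k))) := by
  have h := ((hasDerivAt_binet ht).sub (hasDerivAt_sum_stirling n ht)).const_mul ((-1) ^ n)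
  have he : stirlingRemainder n =ᶠ[𝓝 t] fun t => (-1) ^ n * (binet t - ∑ k ∈ Finset.Icc 1 n,
      ((bernoulli (2 * k) : ℚ) : ℝ) / ((2 * (k : ℝ)) * (2 * (k : ℝ) - 1))
        * (1 / t ^ (2 * k - 1))) := by
    filter_upwards [Ioi_mem_nhds ht] with s hs using stirlingRemainder_eq_binet_sub n hs
  rw [(h.congr_of_eventuallyEq he).deriv]
  ring

theorem pow_mul_neg_deriv_stirlingRemainder (n : ℕ) {t : ℝ} (ht : 0 < t) :
    t ^ (2 * n) * -deriv (stirlingRemainder n) t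
      = (2 * n).factorial * ((-1) ^ n * laplace (poleDensity (2 * n)) t) := by
  rw [neg_deriv_stirlingRemainder n ht, mul_left_comm, pow_mul_laplace_poleDensity_sub n ht]
  ring

/-- The leading term at the origin is the last one subtracted. -/
theorem tendsto_rpow_mul_neg_deriv_stirlingRemainder (n : ℕ) :
    Tendsto (fun t => t ^ (2 * ((n + 1 : ℕ) : ℝ)) * -deriv (stirlingRemainder (n + 1)) t) (𝓝[>] 0)
      (𝓝 ((-1) ^ n * (((bernoulli (2 * (n + 1)) : ℚ) : ℝ) / (2 * ((n + 1 : ℕ) : ℝ))))) := by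
  have h := ((tendsto_pow_succ_mul_laplace_sub n).sub_const
    (((bernoulli (2 * (n + 1)) : ℚ) : ℝ) / (2 * ((n + 1 : ℕ) : ℝ)))).const_mul ((-1) ^ (n + 1))
  have hc : (-1 : ℝ) ^ (n + 1) * (0 - ((bernoulli (2 * (n + 1)) : ℚ) : ℝ)
      / (2 * ((n + 1 : ℕ) : ℝ)))
      = (-1) ^ n * (((bernoulli (2 * (n + 1)) : ℚ) : ℝ) / (2 * ((n + 1 : ℕ) : ℝ))) := by
    ring
  rw [hc] at h
  refine h.congr' ?_
  filter_upwards [self_mem_nhdsWithin] with t ht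
  have ht0 : t ≠ 0 := ne_of_gt ht
  have hp : t ^ (2 * ((n + 1 : ℕ) : ℝ)) = t ^ (2 * (n + 1)) := by
    rw [← Real.rpow_natCast]
    push_cast
    rfl
  rw [neg_deriv_stirlingRemainder _ ht, hp, Finset.sum_Icc_succ_top (by omega), ← sub_sub]
  field_simp

theorem hasCMDegree_stirlingRemainder_zero : HasCMDegree (stirlingRemainder 0) 0 := by
  rw [← EReal.coe_zero]
  refine hasCMDegree_of_tendsto_zero le_rfl ?_ ?_ fun α hα => ?_
  · refine tendsto_binet_atTop.congr' ?_
    filter_upwards [eventually_gt_atTop 0] with t ht using (stirlingRemainder_zero ht).symm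
  · refine isCompletelyMonotonic_binet.congr fun t ht => ?_
    rw [Real.rpow_zero, one_mul, stirlingRemainder_zero ht]
  · refine not_isCompletelyMonotonic_rpow_mul ?_ ⟨1, one_pos, ?_⟩
    · refine (tendsto_rpow_mul_binet hα).congr' ?_
      filter_upwards [self_mem_nhdsWithin] with t ht
      rw [stirlingRemainder_zero ht]
    · -- the value at `1` is `1 - log (2π) / 2`, which is nonzero as `2π < e²`
      have h1 : log (2 * π) < 2 := by
        rw [Real.log_lt_iff_lt_exp (by positivity)]
        have h2 := Real.exp_one_gt_d9
        have h3 : exp 2 = exp 1 * exp 1 := by rw [← Real.exp_add]; norm_num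
        have h4 := Real.pi_lt_d2
        rw [h3]
        nlinarith
      simp [stirlingRemainder]
      linarith

theorem hasCMDegree_stirlingRemainder_one : HasCMDegree (stirlingRemainder 1) 1 := by
  rw [← EReal.coe_one]
  have h0 : Tendsto (fun t => t ^ (1 : ℝ) * stirlingRemainder 1 t) (𝓝[>] 0) (𝓝 (1 / 12)) := by
    have h := (tendsto_rpow_mul_binet one_pos).const_sub (1 / 12)
    rw [sub_zero] at h
    refine h.congr' ?_
    filter_upwards [self_mem_nhdsWithin] with t ht
    have ht0 : t ≠ 0 := ne_of_gt ht
    rw [stirlingRemainder_one ht, Real.rpow_one]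
    field_simp
  have hcm : IsCompletelyMonotonic (fun t => t ^ (1 : ℝ) * stirlingRemainder 1 t) := by
    refine isCompletelyMonotonic_sub_mul_binet.congr fun t ht => ?_
    rw [stirlingRemainder_one ht, Real.rpow_one]
    field_simp
  obtain ⟨r, hr, h1, h2⟩ := exists_hasCMDegree_mem_Icc one_pos (by norm_num) hcm h0
  rwa [le_antisymm h2 h1] at hr

theorem hasCMDegree_neg_deriv_stirlingRemainder_zero :
    HasCMDegree (fun t : ℝ => -deriv (stirlingRemainder 0) t) 1 := by
  rw [← EReal.coe_one]
  have he : ∀ t, 0 < t → t ^ (1 : ℝ) * -deriv (stirlingRemainder 0) t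
      = t * laplace (poleDensity 0) t := fun t ht => by
    rw [Real.rpow_one, neg_deriv_stirlingRemainder 0 ht]
    simp
  have h0 : Tendsto (fun t => t ^ (1 : ℝ) * -deriv (stirlingRemainder 0) t) (𝓝[>] 0)
      (𝓝 (1 / 2)) := by
    refine tendsto_mul_laplace_poleDensity_zero.congr' ?_
    filter_upwards [self_mem_nhdsWithin] with t ht using (he t ht).symm
  obtain ⟨r, hr, h1, h2⟩ := exists_hasCMDegree_mem_Icc one_pos (by norm_num)
    (isCompletelyMonotonic_mul_laplace_poleDensity_zero.congr he) h0
  rwa [le_antisymm h2 h1] at hr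

theorem hasCMDegree_neg_deriv_stirlingRemainder_one :
    HasCMDegree (fun t : ℝ => -deriv (stirlingRemainder 1) t) 2 := by
  have h0 := tendsto_rpow_mul_neg_deriv_stirlingRemainder 0
  simp only [zero_add, Nat.cast_one, mul_one, pow_zero, one_mul] at h0
  have hne : (bernoulli 2 : ℝ) / 2 ≠ 0 :=
    div_ne_zero (bernoulli_two_mul_ne_zero one_ne_zero) two_ne_zero
  have hcm : IsCompletelyMonotonic (fun t => t ^ (2 : ℝ) * -deriv (stirlingRemainder 1) t) := by
    refine (((laplaceConvergent_poleDensity 2).const_mul (-2)).isCompletelyMonotonic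
      fun x hx => ?_).congr fun t ht => ?_
    · have := poleDensity_two_nonpos hx
      linarith
    · have h := pow_mul_neg_deriv_stirlingRemainder 1 ht
      rw [mul_one] at h
      rw [Real.rpow_two, h, laplace_const_mul, Nat.factorial_two]
      push_cast
      ring
  obtain ⟨r, hr, h1, h2⟩ := exists_hasCMDegree_mem_Icc two_pos hne hcm h0
  rw [le_antisymm h2 h1] at hr
  exact_mod_cast hr

theorem exists_hasCMDegree_neg_deriv_stirlingRemainder {n : ℕ} (hn : 1 ≤ n) :
    ∃ r : ℝ, HasCMDegree (fun t : ℝ => -deriv (stirlingRemainder n) t) (r : EReal) ∧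
      2 * (n : ℝ) - 1 ≤ r ∧ r ≤ 2 * (n : ℝ) := by
  obtain ⟨i, rfl⟩ : ∃ i, n = i + 1 := ⟨n - 1, by omega⟩
  refine exists_hasCMDegree_mem_Icc ?_ ?_ ?_ (tendsto_rpow_mul_neg_deriv_stirlingRemainder i)
  · have : (0 : ℝ) ≤ i := i.cast_nonneg
    push_cast
    linarith
  · exact mul_ne_zero (pow_ne_zero _ (by norm_num))
      (div_ne_zero (bernoulli_two_mul_ne_zero i.succ_ne_zero) (by positivity))
  · refine ((isCompletelyMonotonic_laplace_poleDensity_div i).const_mul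
      (c := (2 * (i + 1)).factorial) (by positivity)).congr fun t ht => ?_
    have h := pow_mul_neg_deriv_stirlingRemainder (i + 1) ht
    have hp : t ^ (2 * ((i + 1 : ℕ) : ℝ) - 1) = t ^ (2 * (i + 1)) / t := by
      rw [Real.rpow_sub_one ht.ne', ← Real.rpow_natCast]
      push_cast
      rfl
    rw [hp, div_mul_eq_mul_div, h]
    ring

end

theorem theorem2p1 :
    HasCMDegree (stirlingRemainder 0) 0 ∧
    HasCMDegree (stirlingRemainder 1) 1 ∧
    (∀ (n : ℕ) (t : ℝ), 0 < t →
      DifferentiableAt ℝ (stirlingRemainder n) t ∧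
      -deriv (stirlingRemainder n) t =
        (-1 : ℝ) ^ (n + 1) *
          (digammaReal t - Real.log t + 1 / (2 * t)
            + ∑ k ∈ Finset.Icc 1 n,
                ((bernoulli (2 * k) : ℚ) : ℝ) / (2 * (k : ℝ)) * (1 / t ^ (2 * k)))) ∧
    HasCMDegree (fun t : ℝ => -deriv (stirlingRemainder 0) t) 1 ∧
    HasCMDegree (fun t : ℝ => -deriv (stirlingRemainder 1) t) 2 ∧
    (∀ n : ℕ, 2 ≤ n →
      ∃ r : ℝ, HasCMDegree (fun t : ℝ => -deriv (stirlingRemainder n) t) (r : EReal) ∧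
        2 * (n : ℝ) - 1 ≤ r ∧ r ≤ 2 * (n : ℝ)) :=
  ⟨hasCMDegree_stirlingRemainder_zero, hasCMDegree_stirlingRemainder_one,
    fun n t ht => ⟨(hasDerivAt_stirlingRemainder n ht).differentiableAt, by
      rw [(hasDerivAt_stirlingRemainder n ht).deriv, neg_neg]⟩,
    hasCMDegree_neg_deriv_stirlingRemainder_zero, hasCMDegree_neg_deriv_stirlingRemainder_one,
    fun _ hn => exists_hasCMDegree_neg_deriv_stirlingRemainder (one_le_two.trans hn)⟩
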